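/- Let $p$ be a prime, $r\ge 1$, $q=p^r$, and let $k$ be a field of characteristic $p$ containing $\mathbb F_q$. Let $\mathbb G$ be a linear algebraic group over $k$ (a smooth, connected affine group scheme of finite type over $k$) which is defined over $\mathbb F_p$, i.e. $\mathbb G=\mathbb G_0\times_{\mathbb F_p}k$ for an affine group scheme $\mathbb G_0$ over $\mathbb F_p$, and let $F:\mathbb G\to\mathbb G$ be the corresponding Frobenius morphism. Let $H\subset \mathbb G(\mathbb F_q)$ be a subgroup stable under $F^r$. A $\mathbb G$-module is a comodule over the coordinate algebra $\mathcal O(\mathbb G)$ (of arbitrary dimension), an $H$-module is a $k$-linear representation of $H$ (of arbitrary dimension), and for an $H$-module $M$ the induced module $\mathrm{ind}_H^{\mathbb G}(M)$ is the $\mathbb G$-module of all regular functions $f:\mathbb G\to M$ (elements of $M\otimes\mathcal O(\mathbb G)$) with $f(hx)=h\cdot f(x)$ for all $h\in H$, on which $\mathbb G$ acts by right translation. A $\mathbb G$-module is called mock injective if its restriction to the Frobenius kernel $\mathbb G_{(s)}=\ker(F^s)$ is an injective $\mathbb G_{(s)}$-module for every $s\ge 1$, and proper mock injective if it is mock injective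 but not injective as a $\mathbb G$-module. Theorem. (1) For every $H$-module $M$, the $\mathbb G$-module $\mathrm{ind}_H^{\mathbb G}(M)$ is mock injective. (2) Suppose that every irreducible $H$-module is the restriction to $H$ of a $\mathbb G$-module. Then for every $H$-module $M$, the $\mathbb G$-module $\mathrm{ind}_H^{\mathbb G}(M)$ is proper mock injective if and only if $M$ is not an injective $H$-module. -/

import Mathlib

open scoped TensorProduct

universe u

noncomputable section

/-! ## Comodules, that is, modules over an affine group scheme -/

/-- A right coaction of the coalgebra `C` on the `k`-module `M`.  If `C` is the coordinate algebra
of an affine group scheme `G` over `k`, this is the structure of a `G`-module on `M`. -/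
structure Coaction (k C M : Type*) [CommRing k] [AddCommGroup C] [Module k C] [Coalgebra k C]
    [AddCommGroup M] [Module k M] where
  /-- The structure map `M → M ⊗ C`. -/
  coact : M →ₗ[k] M ⊗[k] C
  coassoc : (TensorProduct.assoc k M C C).toLinearMap ∘ₗ coact.rTensor C ∘ₗ coact =
    (Coalgebra.comul (R := k) (A := C)).lTensor M ∘ₗ coact
  counit_coact : (TensorProduct.rid k M).toLinearMap ∘ₗ
    (Coalgebra.counit (R := k) (A := C)).lTensor M ∘ₗ coact = LinearMap.id

namespace Coaction

variable {k C D M N : Type*} [CommRing k] [AddCommGroup C] [Module k C] [Coalgebra k C]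
  [AddCommGroup D] [Module k D] [Coalgebra k D]
  [AddCommGroup M] [Module k M] [AddCommGroup N] [Module k N]

/-- `f` is a homomorphism of comodules. -/
def IsHom (σ : Coaction k C M) (τ : Coaction k C N) (f : M →ₗ[k] N) : Prop :=
  τ.coact ∘ₗ f = f.rTensor C ∘ₗ σ.coact

/-- Corestriction along a homomorphism of coalgebras `π : C → D`.  For the surjection of coordinate
algebras of a closed subgroup scheme, this is restriction to the subgroup scheme. -/
def res (σ : Coaction k C M) (π : C →ₗc[k] D) : Coaction k D M where
  coact := π.toLinearMap.lTensor M ∘ₗ σ.coact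
  coassoc := by
    have h1 : (TensorProduct.assoc k M D D).toLinearMap ∘ₗ
        (π.toLinearMap.lTensor M ∘ₗ σ.coact).rTensor D ∘ₗ π.toLinearMap.lTensor M ∘ₗ σ.coact =
        (TensorProduct.map π.toLinearMap π.toLinearMap).lTensor M ∘ₗ
        (TensorProduct.assoc k M C C).toLinearMap ∘ₗ σ.coact.rTensor C ∘ₗ σ.coact := by
      have h2 : (TensorProduct.assoc k M D D).toLinearMap ∘ₗ
          (π.toLinearMap.lTensor M ∘ₗ σ.coact).rTensor D ∘ₗ π.toLinearMap.lTensor M =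
          (TensorProduct.map π.toLinearMap π.toLinearMap).lTensor M ∘ₗ
          (TensorProduct.assoc k M C C).toLinearMap ∘ₗ σ.coact.rTensor C := by
        ext m c
        simp only [TensorProduct.AlgebraTensorModule.curry_apply, LinearMap.restrictScalars_self,
          TensorProduct.curry_apply, LinearMap.comp_apply, LinearMap.lTensor_tmul,
          LinearMap.rTensor_tmul, LinearEquiv.coe_coe]
        induction σ.coact m using TensorProduct.induction_on with
        | zero => simp
        | tmul x y => simp
        | add x y hx hy => simp only [map_add, TensorProduct.add_tmul, hx, hy]
      have := congrArg (fun f => f ∘ₗ σ.coact) h2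
      simpa only [LinearMap.comp_assoc] using this
    rw [h1, σ.coassoc, ← LinearMap.comp_assoc, ← LinearMap.comp_assoc, ← LinearMap.lTensor_comp,
      ← LinearMap.lTensor_comp]
    congr 2
    exact π.map_comp_comul
  counit_coact := by
    rw [← LinearMap.comp_assoc σ.coact, ← LinearMap.lTensor_comp, π.counit_comp]
    exact σ.counit_coact

/-- Injectivity of an object of the category of comodules.  (Over a field, the monomorphisms of
comodules are exactly the injective homomorphisms.) -/
def IsInjective {k C M : Type u} [CommRing k] [AddCommGroup C] [Module k C] [Coalgebra k C]
    [AddCommGroup M] [Module k M] (τ : Coaction k C M) : Prop :=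
  ∀ (X Y : Type u) [AddCommGroup X] [Module k X] [AddCommGroup Y] [Module k Y]
    (σX : Coaction k C X) (σY : Coaction k C Y) (i : X →ₗ[k] Y) (f : X →ₗ[k] M),
    σX.IsHom σY i → Function.Injective i → σX.IsHom τ f →
    ∃ g : Y →ₗ[k] M, σY.IsHom τ g ∧ g ∘ₗ i = f

end Coaction

/-! ## Frobenius kernels and mock injective modules -/

section FrobeniusKernel

variable (k A : Type*) [Field k] [CommRing A] [HopfAlgebra k A] (p s : ℕ)

/-- The ideal of the `s`-th Frobenius kernel of the affine group scheme with coordinate algebra `A`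
over a field of characteristic `p`: it is generated by the `p ^ s`-th powers of the elements of the
augmentation ideal. -/
def frobeniusKernelIdeal : Ideal A :=
  Ideal.span {y | ∃ x : A, Coalgebra.counit (R := k) x = 0 ∧ x ^ p ^ s = y}

variable {k A p s}

lemma mk_pow_eq_of_frobeniusKernelIdeal [Fact p.Prime] [CharP k p] (x : A) :
    Ideal.Quotient.mk (frobeniusKernelIdeal k A p s) (x ^ p ^ s) =
      algebraMap k _ (Coalgebra.counit (R := k) x ^ p ^ s) := by
  have hx : (x - algebraMap k A (Coalgebra.counit (R := k) x)) ^ p ^ s ∈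
      frobeniusKernelIdeal k A p s := Ideal.subset_span ⟨_, by simp, rfl⟩
  have : Nontrivial A := (Bialgebra.counitAlgHom k A).toRingHom.domain_nontrivial
  have : CharP A p := charP_of_injective_algebraMap (algebraMap k A).injective p
  rw [sub_pow_char_pow, ← map_pow] at hx
  exact Ideal.Quotient.eq.2 hx

lemma map_mk_comul_pow_of_frobeniusKernelIdeal [Fact p.Prime] [CharP k p] (z : A ⊗[k] A) :
    Algebra.TensorProduct.map (Ideal.Quotient.mkₐ k (frobeniusKernelIdeal k A p s))
      (Ideal.Quotient.mkₐ k (frobeniusKernelIdeal k A p s)) (z ^ p ^ s) =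
    algebraMap k _ (Algebra.TensorProduct.lift (Bialgebra.counitAlgHom k A)
      (Bialgebra.counitAlgHom k A) (fun _ _ => .all _ _) z ^ p ^ s) := by
  have : Nontrivial (A ⊗[k] A) :=
    (Algebra.TensorProduct.lift (Bialgebra.counitAlgHom k A)
      (Bialgebra.counitAlgHom k A) (fun _ _ => .all _ _)).toRingHom.domain_nontrivial
  have : CharP (A ⊗[k] A) p := charP_of_injective_algebraMap (algebraMap k _).injective p
  induction z using TensorProduct.induction_on with
  | zero => simp [Fact.out (p := p.Prime) |>.ne_zero]
  | tmul x y =>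
    rw [Algebra.TensorProduct.tmul_pow, Algebra.TensorProduct.map_tmul,
      Algebra.TensorProduct.lift_tmul, mul_pow, map_mul, Ideal.Quotient.mkₐ_eq_mk,
      mk_pow_eq_of_frobeniusKernelIdeal,
      mk_pow_eq_of_frobeniusKernelIdeal, Algebra.TensorProduct.algebraMap_apply,
      Algebra.algebraMap_eq_smul_one, Algebra.algebraMap_eq_smul_one,
      Algebra.algebraMap_eq_smul_one, Algebra.algebraMap_eq_smul_one, TensorProduct.tmul_smul,
      ← TensorProduct.smul_tmul', ← TensorProduct.smul_tmul', smul_mul_smul_comm, mul_one, smul_smul,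
      mul_comm]
    rfl
  | add x y hx hy =>
    rw [add_pow_char_pow, map_add, hx, hy, map_add, add_pow_char_pow, map_add]

instance frobeniusKernelIdeal.isHopfIdeal [Fact p.Prime] [CharP k p] :
    (frobeniusKernelIdeal k A p s).IsHopfIdeal k where
  counit_eq_zero := by
    have h : frobeniusKernelIdeal k A p s ≤ RingHom.ker (Bialgebra.counitAlgHom k A) := by
      refine Ideal.span_le.2 ?_
      rintro _ ⟨x, hx, rfl⟩
      simp [RingHom.mem_ker, hx, Fact.out (p := p.Prime) |>.ne_zero]
    exact fun x hx => h hx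
  map_mkQ_comul_eq_zero := by
    have h : frobeniusKernelIdeal k A p s ≤ RingHom.ker ((Algebra.TensorProduct.map
        (Ideal.Quotient.mkₐ k (frobeniusKernelIdeal k A p s))
        (Ideal.Quotient.mkₐ k (frobeniusKernelIdeal k A p s))).comp
          (Bialgebra.comulAlgHom k A)) := by
      refine Ideal.span_le.2 ?_
      rintro _ ⟨x, hx, rfl⟩
      rw [SetLike.mem_coe, RingHom.mem_ker, AlgHom.comp_apply, map_pow,
        map_mk_comul_pow_of_frobeniusKernelIdeal]
      have h1 : Algebra.TensorProduct.lift (Bialgebra.counitAlgHom k A)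
          (Bialgebra.counitAlgHom k A) (fun _ _ => .all _ _) (Bialgebra.comulAlgHom k A x) =
          Coalgebra.counit (R := k) x := by
        have := AlgHom.convMul_apply (1 : WithConv (A →ₐ[k] k)) 1 x
        rw [mul_one, AlgHom.convOne_apply] at this
        exact this.symm
      rw [h1, hx, zero_pow (pow_ne_zero _ (Fact.out (p := p.Prime)).ne_zero), map_zero]
    exact fun x hx => h hx
  antipode_mem := by
    have h : frobeniusKernelIdeal k A p s ≤
        (frobeniusKernelIdeal k A p s).comap (HopfAlgebra.antipodeAlgHom k A) := by
      refine Ideal.span_le.2 ?_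
      rintro _ ⟨x, hx, rfl⟩
      rw [SetLike.mem_coe, Ideal.mem_comap, map_pow]
      exact Ideal.subset_span ⟨_, by simpa using hx, rfl⟩
    exact fun x hx => h hx

variable (p) in
/-- A `G`-module is mock injective if its restriction to every Frobenius kernel of `G` is
injective.  Here `A` is the coordinate algebra of `G`. -/
def Coaction.IsMockInjective {k A M : Type u} [Field k] [CommRing A] [HopfAlgebra k A]
    [Fact p.Prime] [CharP k p] [AddCommGroup M] [Module k M] (σ : Coaction k A M) : Prop :=
  ∀ s : ℕ, 0 < s →
    (σ.res (Bialgebra.Quotient.mkBialgHom (R := k)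
      (frobeniusKernelIdeal k A p s)).toCoalgHom).IsInjective

variable (p) in
/-- A mock injective module that is not injective. -/
def Coaction.IsProperMockInjective {k A M : Type u} [Field k] [CommRing A] [HopfAlgebra k A]
    [Fact p.Prime] [CharP k p] [AddCommGroup M] [Module k M] (σ : Coaction k A M) : Prop :=
  σ.IsMockInjective p ∧ ¬ σ.IsInjective

end FrobeniusKernel

/-! ## Rational points, restriction and induction -/

section Induction

variable {k A : Type*} [Field k] [CommRing A] [HopfAlgebra k A]

/-- The action of a rational point `g` on a `G`-module, `v ↦ ∑ g(v₁) v₀`. -/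
def Coaction.pointAction {M : Type*} [AddCommGroup M] [Module k M] (σ : Coaction k A M)
    (g : WithConv (A →ₐ[k] k)) : M →ₗ[k] M :=
  (TensorProduct.rid k M).toLinearMap ∘ₗ g.ofConv.toLinearMap.lTensor M ∘ₗ σ.coact

/-- Left translation of functions on `G` by a rational point `g`, `f ↦ (x ↦ f (g x))`. -/
def leftTranslate (g : WithConv (A →ₐ[k] k)) : A →ₗ[k] A :=
  (TensorProduct.lid k A).toLinearMap ∘ₗ g.ofConv.toLinearMap.rTensor A ∘ₗ Coalgebra.comul

lemma comul_comp_leftTranslate (g : WithConv (A →ₐ[k] k)) :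
    Coalgebra.comul ∘ₗ leftTranslate g =
      (leftTranslate g).rTensor A ∘ₗ Coalgebra.comul (R := k) (A := A) := by
  have h1 : (leftTranslate g).rTensor A = (TensorProduct.lid k (A ⊗[k] A)).toLinearMap ∘ₗ
      g.ofConv.toLinearMap.rTensor (A ⊗[k] A) ∘ₗ (TensorProduct.assoc k A A A).toLinearMap ∘ₗ
      (Coalgebra.comul (R := k) (A := A)).rTensor A := by
    ext a b
    simp only [leftTranslate, TensorProduct.AlgebraTensorModule.curry_apply,
      LinearMap.restrictScalars_self, TensorProduct.curry_apply, LinearMap.comp_apply,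
      LinearMap.rTensor_tmul, LinearEquiv.coe_coe]
    induction Coalgebra.comul (R := k) a using TensorProduct.induction_on with
    | zero => simp
    | tmul x y => simp [TensorProduct.smul_tmul']
    | add x y hx hy => simp only [map_add, TensorProduct.add_tmul, hx, hy]
  have h2 : Coalgebra.comul ∘ₗ leftTranslate g = (TensorProduct.lid k (A ⊗[k] A)).toLinearMap ∘ₗ
      g.ofConv.toLinearMap.rTensor (A ⊗[k] A) ∘ₗ
      (Coalgebra.comul (R := k) (A := A)).lTensor A ∘ₗ Coalgebra.comul := by
    ext a
    simp only [leftTranslate, LinearMap.comp_apply, LinearEquiv.coe_coe]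
    induction Coalgebra.comul (R := k) a using TensorProduct.induction_on with
    | zero => simp
    | tmul x y => simp
    | add x y hx hy => simp only [map_add, hx, hy]
  rw [h1, h2]
  simp only [LinearMap.comp_assoc]
  rw [Coalgebra.coassoc]

variable {Γ M : Type*} [Group Γ] [AddCommGroup M] [Module k M]

/-- The space of the module induced along `ι : Γ → G(k)` from a representation `ρ` of `Γ` on `M`:
all regular functions `f : G → M` such that `f (h x) = h · f x` for `h` in `Γ`. -/
def indSubmodule (ι : Γ →* WithConv (A →ₐ[k] k)) (ρ : Representation k Γ M) :
    Submodule k (M ⊗[k] A) :=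
  ⨅ h : Γ, LinearMap.eqLocus ((ρ h).rTensor A) ((leftTranslate (ι h)).lTensor M)

/-- The right regular coaction on all regular functions `G → M`, `(x · f) (y) = f (y x)`. -/
def rightRegular (k A M : Type*) [Field k] [CommRing A] [HopfAlgebra k A] [AddCommGroup M]
    [Module k M] : M ⊗[k] A →ₗ[k] (M ⊗[k] A) ⊗[k] A :=
  (TensorProduct.assoc k M A A).symm.toLinearMap ∘ₗ Coalgebra.comul.lTensor M

lemma rightRegular_coassoc (k A M : Type*) [Field k] [CommRing A] [HopfAlgebra k A]
    [AddCommGroup M] [Module k M] :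
    (TensorProduct.assoc k (M ⊗[k] A) A A).toLinearMap ∘ₗ (rightRegular k A M).rTensor A ∘ₗ
      rightRegular k A M = Coalgebra.comul.lTensor (M ⊗[k] A) ∘ₗ rightRegular k A M := by
  let e := (TensorProduct.assoc k M A (A ⊗[k] A)).symm.toLinearMap
  have h1 : (TensorProduct.assoc k (M ⊗[k] A) A A).toLinearMap ∘ₗ (rightRegular k A M).rTensor A ∘ₗ
      (TensorProduct.assoc k M A A).symm.toLinearMap = e ∘ₗ
      ((TensorProduct.assoc k A A A).toLinearMap ∘ₗ
        (Coalgebra.comul (R := k) (A := A)).rTensor A).lTensor M := by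
    ext m a b
    simp only [e, rightRegular, TensorProduct.AlgebraTensorModule.curry_apply,
      LinearMap.restrictScalars_self, TensorProduct.curry_apply, LinearMap.comp_apply,
      LinearMap.lTensor_tmul, LinearMap.rTensor_tmul, LinearEquiv.coe_coe,
      TensorProduct.assoc_symm_tmul]
    induction Coalgebra.comul (R := k) a using TensorProduct.induction_on with
    | zero => simp
    | tmul x y => simp
    | add x y hx hy =>
      simp only [map_add, TensorProduct.tmul_add, TensorProduct.add_tmul, hx, hy]
  have h2 : Coalgebra.comul.lTensor (M ⊗[k] A) ∘ₗ
      (TensorProduct.assoc k M A A).symm.toLinearMap = e ∘ₗ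
      ((Coalgebra.comul (R := k) (A := A)).lTensor A).lTensor M := by
    ext m a b
    simp [e]
  have h3 : ((TensorProduct.assoc k A A A).toLinearMap ∘ₗ
        (Coalgebra.comul (R := k) (A := A)).rTensor A).lTensor M ∘ₗ Coalgebra.comul.lTensor M =
      ((Coalgebra.comul (R := k) (A := A)).lTensor A).lTensor M ∘ₗ Coalgebra.comul.lTensor M := by
    rw [← LinearMap.lTensor_comp, ← LinearMap.lTensor_comp, LinearMap.comp_assoc,
      Coalgebra.coassoc]
  calc _ = ((TensorProduct.assoc k (M ⊗[k] A) A A).toLinearMap ∘ₗ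
        (rightRegular k A M).rTensor A ∘ₗ (TensorProduct.assoc k M A A).symm.toLinearMap) ∘ₗ
        Coalgebra.comul.lTensor M := rfl
    _ = (Coalgebra.comul.lTensor (M ⊗[k] A) ∘ₗ (TensorProduct.assoc k M A A).symm.toLinearMap) ∘ₗ
        Coalgebra.comul.lTensor M := by
        rw [h1, h2, LinearMap.comp_assoc, h3, LinearMap.comp_assoc]
    _ = _ := rfl

lemma rightRegular_counit (k A M : Type*) [Field k] [CommRing A] [HopfAlgebra k A]
    [AddCommGroup M] [Module k M] :
    (TensorProduct.rid k (M ⊗[k] A)).toLinearMap ∘ₗ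
      (Coalgebra.counit (R := k) (A := A)).lTensor (M ⊗[k] A) ∘ₗ rightRegular k A M =
      LinearMap.id := by
  ext m a
  have h : ∀ z : A ⊗[k] A, TensorProduct.rid k (M ⊗[k] A)
      ((Coalgebra.counit (R := k) (A := A)).lTensor (M ⊗[k] A)
        ((TensorProduct.assoc k M A A).symm (m ⊗ₜ z))) =
      m ⊗ₜ TensorProduct.rid k A ((Coalgebra.counit (R := k) (A := A)).lTensor A z) := by
    intro z
    induction z using TensorProduct.induction_on with
    | zero => simp
    | tmul x y => simp
    | add x y hx hy => simp only [map_add, TensorProduct.tmul_add, hx, hy]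
  have := h (Coalgebra.comul a)
  rw [Coalgebra.lTensor_counit_comul] at this
  simpa [rightRegular] using this

lemma mem_range_rTensor_of_forall {V W : Type*} [AddCommGroup V] [Module k V] [AddCommGroup W]
    [Module k W] (N : Submodule k V) (y : V ⊗[k] W)
    (h : ∀ φ : W →ₗ[k] k, TensorProduct.rid k V (φ.lTensor V y) ∈ N) :
    y ∈ LinearMap.range (N.subtype.rTensor W) := by
  have hex := rTensor_exact W (LinearMap.exact_subtype_mkQ N) N.mkQ_surjective
  rw [← hex.linearMap_ker_eq, LinearMap.mem_ker]
  have h1 : ∀ φ : W →ₗ[k] k, TensorProduct.rid k _ (φ.lTensor (V ⧸ N) (N.mkQ.rTensor W y)) = 0 := by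
    intro φ
    have h2 : (TensorProduct.rid k (V ⧸ N)).toLinearMap ∘ₗ φ.lTensor (V ⧸ N) ∘ₗ N.mkQ.rTensor W =
        N.mkQ ∘ₗ (TensorProduct.rid k V).toLinearMap ∘ₗ φ.lTensor V := by
      ext v w
      simp
    have h3 := LinearMap.congr_fun h2 y
    simp only [LinearMap.comp_apply, LinearEquiv.coe_coe] at h3
    rw [h3]
    exact (Submodule.Quotient.mk_eq_zero N).2 (h φ)
  generalize N.mkQ.rTensor W y = z at h1
  classical
  let b := Module.Basis.ofVectorSpace k W
  apply (TensorProduct.equivFinsuppOfBasisRight (M := V ⧸ N) b).injective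
  ext i
  rw [map_zero, Finsupp.zero_apply, TensorProduct.equivFinsuppOfBasisRight_apply, h1]

lemma rightRegular_mem (ι : Γ →* WithConv (A →ₐ[k] k)) (ρ : Representation k Γ M)
    (x : M ⊗[k] A) (hx : x ∈ indSubmodule ι ρ) :
    rightRegular k A M x ∈ LinearMap.range ((indSubmodule ι ρ).subtype.rTensor A) := by
  refine mem_range_rTensor_of_forall _ _ fun φ => ?_
  -- slicing the coaction with `φ` is the endomorphism `id ⊗ T` of `M ⊗ A`
  let T : A →ₗ[k] A := (TensorProduct.rid k A).toLinearMap ∘ₗ φ.lTensor A ∘ₗ Coalgebra.comul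
  have hT : (TensorProduct.rid k (M ⊗[k] A)).toLinearMap ∘ₗ φ.lTensor (M ⊗[k] A) ∘ₗ
      rightRegular k A M = T.lTensor M := by
    ext m a
    simp only [T, rightRegular, TensorProduct.AlgebraTensorModule.curry_apply,
      LinearMap.restrictScalars_self, TensorProduct.curry_apply, LinearMap.comp_apply,
      LinearMap.lTensor_tmul, LinearEquiv.coe_coe]
    induction Coalgebra.comul (R := k) a using TensorProduct.induction_on with
    | zero => simp
    | tmul x y => simp
    | add x y hx hy => simp only [map_add, TensorProduct.tmul_add, hx, hy]
  have hTx := LinearMap.congr_fun hT x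
  simp only [LinearMap.comp_apply, LinearEquiv.coe_coe] at hTx
  rw [hTx]
  have hcomm : ∀ g : WithConv (A →ₐ[k] k), T ∘ₗ leftTranslate g = leftTranslate g ∘ₗ T := by
    intro g
    have h1 : (TensorProduct.rid k A).toLinearMap ∘ₗ φ.lTensor A ∘ₗ (leftTranslate g).rTensor A =
        leftTranslate g ∘ₗ (TensorProduct.rid k A).toLinearMap ∘ₗ φ.lTensor A := by
      ext a b
      simp
    simp only [T, LinearMap.comp_assoc]
    rw [comul_comp_leftTranslate]
    have := congrArg (fun f => f ∘ₗ (Coalgebra.comul (R := k) (A := A))) h1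
    simpa only [LinearMap.comp_assoc] using this
  simp only [indSubmodule, Submodule.mem_iInf, LinearMap.mem_eqLocus] at hx ⊢
  intro h
  rw [← LinearMap.comp_apply (LinearMap.rTensor _ _), LinearMap.rTensor_comp_lTensor,
    ← LinearMap.lTensor_comp_rTensor, LinearMap.comp_apply, hx h, ← LinearMap.lTensor_comp_apply,
    ← LinearMap.lTensor_comp_apply, hcomm]

/-- `G` acts on the induced module by right translation of functions; this is the restriction of the
right regular coaction, see `rTensor_subtype_indCoact`. -/
def indCoact (ι : Γ →* WithConv (A →ₐ[k] k)) (ρ : Representation k Γ M) :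
    indSubmodule ι ρ →ₗ[k] indSubmodule ι ρ ⊗[k] A :=
  (LinearEquiv.ofInjective ((indSubmodule ι ρ).subtype.rTensor A)
    (Module.Flat.rTensor_preserves_injective_linearMap _ (Submodule.subtype_injective _))).symm ∘ₗ
  (rightRegular k A M).restrict (rightRegular_mem ι ρ)

lemma rTensor_subtype_indCoact (ι : Γ →* WithConv (A →ₐ[k] k)) (ρ : Representation k Γ M) :
    (indSubmodule ι ρ).subtype.rTensor A ∘ₗ indCoact ι ρ =
      rightRegular k A M ∘ₗ (indSubmodule ι ρ).subtype := by
  ext1 x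
  exact congrArg Subtype.val (LinearEquiv.apply_symm_apply
    (LinearEquiv.ofInjective ((indSubmodule ι ρ).subtype.rTensor A)
      (Module.Flat.rTensor_preserves_injective_linearMap _ (Submodule.subtype_injective _)))
    ((rightRegular k A M).restrict (rightRegular_mem ι ρ) x))

/-- The `G`-module induced along `ι : Γ → G(k)` from a representation `ρ` of the group `Γ`. -/
def ind (ι : Γ →* WithConv (A →ₐ[k] k)) (ρ : Representation k Γ M) :
    Coaction k A (indSubmodule ι ρ) where
  coact := indCoact ι ρ
  coassoc := by
    have hinj : Function.Injective ((indSubmodule ι ρ).subtype.rTensor (A ⊗[k] A)) :=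
      Module.Flat.rTensor_preserves_injective_linearMap _ (Submodule.subtype_injective _)
    rw [← LinearMap.cancel_left hinj]
    have h := rTensor_subtype_indCoact ι ρ
    have h1 : (indSubmodule ι ρ).subtype.rTensor (A ⊗[k] A) ∘ₗ
        (TensorProduct.assoc k (indSubmodule ι ρ) A A).toLinearMap =
        (TensorProduct.assoc k (M ⊗[k] A) A A).toLinearMap ∘ₗ
          ((indSubmodule ι ρ).subtype.rTensor A).rTensor A := by
      ext x a b
      simp
    have h2 : (indSubmodule ι ρ).subtype.rTensor (A ⊗[k] A) ∘ₗ Coalgebra.comul.lTensor _ =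
        Coalgebra.comul.lTensor _ ∘ₗ (indSubmodule ι ρ).subtype.rTensor A := by
      rw [LinearMap.rTensor_comp_lTensor, LinearMap.lTensor_comp_rTensor]
    calc _ = (TensorProduct.assoc k (M ⊗[k] A) A A).toLinearMap ∘ₗ
          ((indSubmodule ι ρ).subtype.rTensor A ∘ₗ indCoact ι ρ).rTensor A ∘ₗ indCoact ι ρ := by
          rw [← LinearMap.comp_assoc, h1, LinearMap.rTensor_comp]
          simp only [LinearMap.comp_assoc]
      _ = (TensorProduct.assoc k (M ⊗[k] A) A A).toLinearMap ∘ₗ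
          (rightRegular k A M).rTensor A ∘ₗ rightRegular k A M ∘ₗ (indSubmodule ι ρ).subtype := by
          rw [h, LinearMap.rTensor_comp, ← h]
          simp only [LinearMap.comp_assoc]
      _ = Coalgebra.comul.lTensor _ ∘ₗ rightRegular k A M ∘ₗ (indSubmodule ι ρ).subtype := by
          have := congrArg (fun f => f ∘ₗ (indSubmodule ι ρ).subtype) (rightRegular_coassoc k A M)
          simpa only [LinearMap.comp_assoc] using this
      _ = _ := by
          rw [← h, ← LinearMap.comp_assoc, ← h2, LinearMap.comp_assoc]
  counit_coact := by
    rw [← LinearMap.cancel_left (indSubmodule ι ρ).subtype_injective]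
    have h1 : (indSubmodule ι ρ).subtype ∘ₗ (TensorProduct.rid k (indSubmodule ι ρ)).toLinearMap ∘ₗ
        (Coalgebra.counit (R := k) (A := A)).lTensor _ =
        (TensorProduct.rid k (M ⊗[k] A)).toLinearMap ∘ₗ
        (Coalgebra.counit (R := k) (A := A)).lTensor _ ∘ₗ
          (indSubmodule ι ρ).subtype.rTensor A := by
      ext x a
      simp
    have h2 := congrArg (fun f => f ∘ₗ indCoact ι ρ) h1
    simp only [LinearMap.comp_assoc] at h2
    rw [h2, rTensor_subtype_indCoact, LinearMap.comp_id]
    have h3 := congrArg (fun f => f ∘ₗ (indSubmodule ι ρ).subtype) (rightRegular_counit k A M)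
    simpa only [LinearMap.comp_assoc, LinearMap.id_comp] using h3

end Induction

/-! ## Linear algebraic groups and groups defined over the prime field -/

/-- `A` is the coordinate algebra of a linear algebraic group over `k`, that is, of a smooth and
connected affine group scheme of finite type. -/
structure IsLinearAlgebraicGroup (k A : Type*) [Field k] [CommRing A] [HopfAlgebra k A] :
    Prop where
  smooth : Algebra.Smooth k A
  connected : ConnectedSpace (PrimeSpectrum A)

variable (p : ℕ) [Fact p.Prime] (k K R : Type*) [Field k] [Algebra (ZMod p) k] [Field K]
  [Algebra (ZMod p) K] [Algebra K k] [CommRing R] [HopfAlgebra (ZMod p) R]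

/-- Let `G₀` be the affine group scheme over `𝔽_p` with coordinate algebra `R`, and `G` its base
change to `k`, with coordinate algebra `k ⊗ R`.  This is the subset `G₀(K)` of `G(k)`, for a field
`K` contained in `k`. -/
def rationalPoints : Set (WithConv ((k ⊗[ZMod p] R) →ₐ[k] k)) :=
  {g | ∃ g₀ : R →ₐ[ZMod p] K, ∀ x : R, g.ofConv (1 ⊗ₜ[ZMod p] x) = algebraMap K k (g₀ x)}

/-- The action on `G(k)` of the Frobenius morphism `F : G → G` over `k`, the base change of the
morphism `G₀ → G₀` given by the `p`-power map of `R`. -/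
def frobeniusOnPoints (g : WithConv ((k ⊗[ZMod p] R) →ₐ[k] k)) :
    WithConv ((k ⊗[ZMod p] R) →ₐ[k] k) :=
  WithConv.toConv (g.ofConv.comp
    (Algebra.TensorProduct.map (AlgHom.id k k) (FiniteField.frobeniusAlgHom (ZMod p) R)))

end

/-!
Write `A` for the coordinate algebra of `G` and `C` for the coordinate algebra of a Frobenius
kernel `N`, with quotient map `π : A → C`.

*Mock injectivity.* A comodule `V` over `C` is a direct summand of the cofree comodule `V ⊗ C`,
and so injective, as soon as it is a module over a comodule algebra `B` with a *total integral*, a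
comodule map `φ : C → B` with `φ(1) = 1`: the retraction is `v ⊗ c ↦ ∑ φ(S(v₁) c) v₀`
(`Coaction.isInjective_of_compatible`). The algebra `A` itself has a total integral
(`exists_totalIntegral`). Indeed, the finite-dimensional Hopf algebra `C` carries a nonzero
integral `t`, given by an explicit trace formula (`slice_traceIntegral_comul`,
`exists_traceIntegral_ne_zero`), and the averaging operator `T(a) = ∑ a₁ t(π(a₂))` takes values in
the `N`-invariant functions. As `T` commutes with left translations and does not vanish
identically at the unit element, its values generate the unit ideal of `A`; as `A` is integral
over the invariants (they contain all `p ^ s`-th powers), `T` takes the value `1`.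

The total integral of `A` is then transported along the Lang map `x ↦ F(x)⁻¹ x`, with `F` a power
of the Frobenius endomorphism. If the power is a multiple of `r`, then `F` fixes the points of
`H`, and the Lang map takes values in the functions invariant under left translation by `H`, which
act on `ind M`. If the power is at least `s`, then `F` is trivial on the `s`-th Frobenius kernel
and the Lang map is equivariant for it. So `ind M` is a module over a comodule algebra with a
total integral (`ind_res_isInjective`, `ind_isMockInjective`).

*Injectivity.* Induction is right adjoint to restriction, so it preserves injectivity
(`ind_isInjective`). Conversely, the group `H` is finite (`finite_rationalPoints`) and acts freely
on `G`, so some function has trace `1` over the `H`-invariant functions; this follows from the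
same argument as for `T`, with linear independence of characters in place of the integral
(`exists_sum_leftTranslate_eq_one`). Averaging with this function shows that induction is exact
(`indMap_surjective`). If `ind M` is injective and `0 → M → E → Q → 0` is exact, the induced
sequence splits, so by Frobenius reciprocity a homomorphism `S → Q` lifts to `E` whenever `S` is
the restriction of a `G`-module (`exists_equivariant_lift`). If this applies to all simple `S`,
then no simple module has a nontrivial extension by `M`, and since the group algebra is Artinian,
`M` is injective (`Module.injective_of_forall_simple_lift`).
-/

noncomputable section

/-! ### Convolution identities in commutative Hopf algebras -/

section HopfIdentities

open WithConv Algebra.TensorProduct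

variable {k C : Type*} [Field k] [CommRing C] [HopfAlgebra k C]

lemma toConv_includeLeft_mul_includeRight :
    (toConv includeLeft * toConv includeRight : WithConv (C →ₐ[k] C ⊗[k] C)) =
      toConv (Bialgebra.comulAlgHom k C) := by
  rw [AlgHom.convMul_def]
  congr 1
  have : (lmul' k).comp (map (includeLeft : C →ₐ[k] C ⊗[k] C) (includeRight : C →ₐ[k] C ⊗[k] C)) =
      AlgHom.id k _ := by
    ext <;> simp
  rw [← AlgHom.comp_assoc, ofConv_toConv, ofConv_toConv, this, AlgHom.id_comp]

lemma toConv_comp_antipodeAlgHom {D : Type*} [CommRing D] [Bialgebra k D] (f : C →ₐ[k] D) :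
    toConv (f.comp (HopfAlgebra.antipodeAlgHom k C)) = (toConv f)⁻¹ := rfl

/-- `∑ Δ(S c₁) (c₂ ⊗ 1) = 1 ⊗ S c`. -/
lemma lift_comul_antipode_includeLeft (c : C) :
    lift ((Bialgebra.comulAlgHom k C).comp (HopfAlgebra.antipodeAlgHom k C))
      (includeLeft : C →ₐ[k] C ⊗[k] C) (fun _ _ => .all _ _) (Coalgebra.comul (R := k) c) =
      (1 : C) ⊗ₜ[k] HopfAlgebra.antipode k c := by
  have h : toConv ((Bialgebra.comulAlgHom k C).comp (HopfAlgebra.antipodeAlgHom k C)) *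
      (toConv includeLeft : WithConv (C →ₐ[k] C ⊗[k] C)) =
        toConv ((includeRight : C →ₐ[k] C ⊗[k] C).comp
        (HopfAlgebra.antipodeAlgHom k C)) := by
    rw [toConv_comp_antipodeAlgHom, toConv_comp_antipodeAlgHom,
      ← toConv_includeLeft_mul_includeRight]
    group
  have := congrArg (fun f => f.ofConv c) h
  exact (AlgHom.convMul_apply _ _ c).symm.trans this

/-- `∑ (1 ⊗ c₁) Δ(S c₂) = S c ⊗ 1`. -/
lemma lift_includeRight_comul_antipode (c : C) :
    lift includeRight ((Bialgebra.comulAlgHom k C).comp (HopfAlgebra.antipodeAlgHom k C))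
      (fun _ _ => .all _ _) (Coalgebra.comul c) = HopfAlgebra.antipode k c ⊗ₜ[k] (1 : C) := by
  have h : (toConv includeRight : WithConv (C →ₐ[k] C ⊗[k] C)) *
      toConv ((Bialgebra.comulAlgHom k C).comp (HopfAlgebra.antipodeAlgHom k C)) =
      toConv ((includeLeft : C →ₐ[k] C ⊗[k] C).comp (HopfAlgebra.antipodeAlgHom k C)) := by
    rw [toConv_comp_antipodeAlgHom, toConv_comp_antipodeAlgHom,
      ← toConv_includeLeft_mul_includeRight]
    group
  have := congrArg (fun f => f.ofConv c) h
  exact (AlgHom.convMul_apply _ _ c).symm.trans this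

variable (k C) in
/-- The automorphism `(g, h) ↦ (g, g h)` of the group scheme `G × G` over its first factor, on
coordinate algebras: `c ⊗ y ↦ (c ⊗ 1) Δ(y)`. -/
def shearEquiv : C ⊗[k] C ≃ₐ[C] C ⊗[k] C :=
  AlgEquiv.ofAlgHom
    (lift (Algebra.ofId C (C ⊗[k] C)) (Bialgebra.comulAlgHom k C) (fun _ _ => .all _ _))
    (lift (Algebra.ofId C (C ⊗[k] C))
      ((toConv includeLeft)⁻¹ * toConv includeRight : WithConv (C →ₐ[k] C ⊗[k] C)).ofConv
      (fun _ _ => .all _ _))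
    (by
      ext1
      set Φ := lift (Algebra.ofId C (C ⊗[k] C)) (Bialgebra.comulAlgHom k C) (fun _ _ => .all _ _)
      have h1 : (Φ.restrictScalars k).comp includeLeft = includeLeft := by
        ext x; simp [Φ, Algebra.ofId_apply]
      have h2 : (Φ.restrictScalars k).comp includeRight = Bialgebra.comulAlgHom k C := by
        ext x; simp [Φ]
      have h : (Φ.restrictScalars k).comp
          ((toConv includeLeft)⁻¹ * toConv includeRight : WithConv (C →ₐ[k] C ⊗[k] C)).ofConv =
          includeRight := by
        rw [AlgHom.comp_convMul_distrib, ofConv_toConv, h2, ← toConv_comp_antipodeAlgHom,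
          ofConv_toConv, ← AlgHom.comp_assoc, h1, toConv_comp_antipodeAlgHom,
          ← toConv_includeLeft_mul_includeRight]
        exact congrArg ofConv (inv_mul_cancel_left
          (toConv includeLeft : WithConv (C →ₐ[k] C ⊗[k] C)) (toConv includeRight))
      ext y
      simpa [Algebra.ofId_apply, Φ, ← Algebra.TensorProduct.one_def] using AlgHom.congr_fun h y)
    (by
      ext1
      set Φ := lift (Algebra.ofId C (C ⊗[k] C))
        ((toConv includeLeft)⁻¹ * toConv includeRight : WithConv (C →ₐ[k] C ⊗[k] C)).ofConv
        (fun _ _ => .all _ _)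
      have h1 : (Φ.restrictScalars k).comp includeLeft = includeLeft := by
        ext x; simp [Φ, Algebra.ofId_apply]
      have h2 : (Φ.restrictScalars k).comp includeRight =
          ((toConv includeLeft)⁻¹ * toConv includeRight :
            WithConv (C →ₐ[k] C ⊗[k] C)).ofConv := by
        ext x; simp [Φ]
      have h : (Φ.restrictScalars k).comp (Bialgebra.comulAlgHom k C) = includeRight := by
        rw [← ofConv_toConv (Bialgebra.comulAlgHom k C), ← toConv_includeLeft_mul_includeRight,
          AlgHom.comp_convMul_distrib, ofConv_toConv, ofConv_toConv, h2, h1, toConv_ofConv]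
        exact congrArg ofConv (mul_inv_cancel_left
          (toConv includeLeft : WithConv (C →ₐ[k] C ⊗[k] C)) (toConv includeRight))
      ext y
      simpa [Algebra.ofId_apply, Φ, ← Algebra.TensorProduct.one_def] using AlgHom.congr_fun h y)

end HopfIdentities

/-! ### Integrals on finite-dimensional commutative Hopf algebras -/

section Integral

variable {k C M : Type*} [Field k] [AddCommGroup M] [Module k M]

/-- The slice `m ⊗ c ↦ f(c) m` of a tensor along a functional `f`. -/
def slice {C : Type*} [AddCommGroup C] [Module k C] (M : Type*) [AddCommGroup M] [Module k M]
    (f : C →ₗ[k] k) : M ⊗[k] C →ₗ[k] M :=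
  (TensorProduct.rid k M).toLinearMap ∘ₗ f.lTensor M

@[simp]
lemma slice_tmul {C : Type*} [AddCommGroup C] [Module k C] (f : C →ₗ[k] k) (m : M) (c : C) :
    slice M f (m ⊗ₜ c) = f c • m := by
  simp [slice]

/-- Slicing a coaction by `f` and then coacting amounts to letting `f` act on the last factor of
the comultiplication. -/
lemma Coaction.coact_slice [AddCommGroup C] [Module k C] [Coalgebra k C] (σ : Coaction k C M)
    (f : C →ₗ[k] k) (v : M) :
    σ.coact (slice M f (σ.coact v)) =
      (slice C f ∘ₗ Coalgebra.comul).lTensor M (σ.coact v) := by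
  have h1 : σ.coact ∘ₗ slice M f = slice (M ⊗[k] C) f ∘ₗ σ.coact.rTensor C := by
    ext m c; simp
  have h2 : slice (M ⊗[k] C) f ∘ₗ (TensorProduct.assoc k M C C).symm.toLinearMap =
      (slice C f).lTensor M := by
    ext m c d; simp
  have h3 := LinearMap.congr_fun σ.coassoc v
  simp only [LinearMap.comp_apply, LinearEquiv.coe_coe] at h3
  calc _ = slice (M ⊗[k] C) f (σ.coact.rTensor C (σ.coact v)) := LinearMap.congr_fun h1 _
    _ = slice (M ⊗[k] C) f ((TensorProduct.assoc k M C C).symm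
          (TensorProduct.assoc k M C C (σ.coact.rTensor C (σ.coact v)))) := by simp
    _ = (slice C f).lTensor M (Coalgebra.comul.lTensor M (σ.coact v)) := by
        rw [h3]; exact LinearMap.congr_fun h2 _
    _ = _ := by rw [LinearMap.lTensor_comp_apply]

/-- The right regular coaction of a coalgebra on itself. -/
def Coaction.regular (k C : Type*) [CommRing k] [AddCommGroup C] [Module k C] [Coalgebra k C] :
    Coaction k C C where
  coact := Coalgebra.comul
  coassoc := Coalgebra.coassoc
  counit_coact := by ext; simp

variable [CommRing C] [HopfAlgebra k C]

lemma comul_slice_comul (f : C →ₗ[k] k) (y : C) :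
    Coalgebra.comul (R := k) (slice C f (Coalgebra.comul y)) =
      (slice C f ∘ₗ Coalgebra.comul).lTensor C (Coalgebra.comul y) :=
  (Coaction.regular k C).coact_slice f y

/-- The functional `x ↦ Tr (y ↦ ∑ x₁ y₁ f(x₂ y₂))` on a finite-dimensional Hopf algebra. -/
def traceIntegral (f : C →ₗ[k] k) : C →ₗ[k] k :=
  LinearMap.trace k C ∘ₗ LinearMap.mulLeft k (slice C f ∘ₗ Coalgebra.comul : Module.End k C) ∘ₗ
    LinearMap.mul k C

lemma traceIntegral_apply (f : C →ₗ[k] k) (x : C) :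
    traceIntegral f x =
      LinearMap.trace k C ((slice C f ∘ₗ Coalgebra.comul) ∘ₗ LinearMap.mulLeft k x) := rfl

variable [FiniteDimensional k C]

/-- The shear automorphism of `C ⊗ C` conjugates multiplication by `1 ⊗ x` followed by slicing to
multiplication by `Δ(x)` followed by slicing.  Comparing traces over the left factor shows that the
trace functional is an integral. -/
lemma slice_traceIntegral_comul (f : C →ₗ[k] k) (x : C) :
    slice C (traceIntegral f) (Coalgebra.comul x) = algebraMap k C (traceIntegral f x) := by
  set R : C →ₗ[k] C := slice C f ∘ₗ Coalgebra.comul with hR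
  have h1 : ∀ z : C ⊗[k] C, LinearMap.trace C (C ⊗[k] C)
      (R.baseChange C ∘ₗ LinearMap.mulLeft C z) = slice C (traceIntegral f) z := by
    intro z
    induction z using TensorProduct.induction_on with
    | zero => simp
    | tmul a b =>
      have : R.baseChange C ∘ₗ LinearMap.mulLeft C (a ⊗ₜ[k] b) =
          a • (R ∘ₗ LinearMap.mulLeft k b).baseChange C := by
        ext y; simp [TensorProduct.smul_tmul']
      rw [this, map_smul, LinearMap.trace_baseChange, slice_tmul, traceIntegral_apply, ← hR,
        smul_eq_mul, Algebra.smul_def, mul_comm]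
    | add z w hz hw =>
      have : R.baseChange C ∘ₗ LinearMap.mulLeft C (z + w) =
          R.baseChange C ∘ₗ LinearMap.mulLeft C z + R.baseChange C ∘ₗ LinearMap.mulLeft C w := by
        rw [← LinearMap.comp_add]; congr 1; ext; simp [add_mul]
      rw [this, map_add, hz, hw, map_add]
  -- on elements `1 ⊗ y` this is coassociativity and multiplicativity of `Δ`
  have h2 : R.baseChange C ∘ₗ LinearMap.mulLeft C (Coalgebra.comul x) =
      (shearEquiv k C).toLinearEquiv.conj ((R ∘ₗ LinearMap.mulLeft k x).baseChange C) := by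
    rw [LinearEquiv.conj_apply, LinearEquiv.eq_comp_toLinearMap_symm]
    ext y
    have h3 : ∀ y : C, shearEquiv k C (1 ⊗ₜ y) = Coalgebra.comul y := by
      intro y
      simp [shearEquiv, ← Algebra.TensorProduct.one_def]
    have h4 := comul_slice_comul f (x * y)
    simp only [TensorProduct.AlgebraTensorModule.curry_apply, TensorProduct.curry_apply,
      LinearMap.comp_apply, LinearEquiv.coe_coe, LinearMap.baseChange_tmul,
      AlgEquiv.toLinearEquiv_apply, h3, LinearMap.mulLeft_apply, LinearMap.coe_restrictScalars]
    rw [hR, LinearMap.comp_apply, h4, Bialgebra.comul_mul]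
    rfl
  rw [← h1, h2, LinearMap.trace_conj', LinearMap.trace_baseChange]
  rfl

/-- The rank-one operator `y ↦ ε(y) 1 = ∑ y₁ S(y₂)` has trace one, and it is a combination of
the operators that define the trace functionals. -/
lemma exists_traceIntegral_ne_zero : ∃ f : C →ₗ[k] k, traceIntegral f ≠ 0 := by
  by_contra! h
  let b := Module.finBasis k C
  have h1 : (Coalgebra.counit (R := k) (A := C)).smulRight (1 : C) =
      ∑ i, LinearMap.mulLeft k (HopfAlgebra.antipode k (b i)) *
        (slice C (b.coord i) ∘ₗ Coalgebra.comul : Module.End k C) := by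
    ext y
    -- expand the second factor in the basis `b`
    have h2 : ∀ z : C ⊗[k] C, LinearMap.mul' k C ((HopfAlgebra.antipode k).lTensor C z) =
        ∑ i, HopfAlgebra.antipode k (b i) * slice C (b.coord i) z := by
      intro z
      induction z using TensorProduct.induction_on with
      | zero => simp
      | tmul c d =>
        simp only [LinearMap.lTensor_tmul, LinearMap.mul'_apply, slice_tmul,
          Module.Basis.coord_apply]
        conv_lhs => rw [← b.sum_repr d]
        rw [map_sum, Finset.mul_sum]
        refine Finset.sum_congr rfl fun i _ => ?_
        rw [map_smul, mul_smul_comm, mul_smul_comm, mul_comm]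
      | add z w hz hw => simp only [map_add, hz, hw, mul_add, Finset.sum_add_distrib]
    have h3 := h2 (Coalgebra.comul y)
    rw [HopfAlgebra.mul_antipode_lTensor_comul_apply] at h3
    simpa [Algebra.algebraMap_eq_smul_one] using h3
  have h4 := congrArg (LinearMap.trace k C) h1
  rw [LinearMap.trace_smulRight, map_sum, Bialgebra.counit_one] at h4
  refine one_ne_zero (h4.trans (Finset.sum_eq_zero fun i _ => ?_))
  rw [LinearMap.trace_mul_comm]
  exact LinearMap.congr_fun (h (b.coord i)) _

end Integral

/-! ### Averaging operators on a Hopf algebra -/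

section Averaging

/-- If `A` is integral over `B`, a `B`-linear map `T : A → B` whose values generate the unit ideal
of `A` takes the value `1`: its image is an ideal of `B`, and no proper ideal of `B` generates the
unit ideal of `A`. -/
lemma exists_apply_eq_one_of_span_range_eq_top {k A : Type*} [Field k] [CommRing A] [Algebra k A]
    (B : Subalgebra k A) [Algebra.IsIntegral B A] (T : A →ₗ[B] B)
    (h : Ideal.span (Set.range fun a => (T a : A)) = ⊤) : ∃ a, T a = 1 := by
  have h1 : Ideal.map (algebraMap B A) (LinearMap.range T) = ⊤ := by
    rw [eq_top_iff, ← h, Ideal.span_le]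
    rintro _ ⟨a, rfl⟩
    exact Ideal.mem_map_of_mem (algebraMap B A) (LinearMap.mem_range_self T a)
  have h2 := (Ideal.map_eq_top_iff (algebraMap B A) (FaithfulSMul.algebraMap_injective B A)
    (algebraMap_isIntegral_iff.2 inferInstance)).1 h1
  exact LinearMap.mem_range.1 (h2 ▸ Submodule.mem_top : (1 : B) ∈ LinearMap.range T)

variable {k A : Type*} [Field k] [CommRing A] [HopfAlgebra k A]

/-- The values of an operator that commutes with left translations and does not vanish identically
at the unit element generate the unit ideal: `1 = ε(T a) = ∑ S(a₁) T(a₂)`. -/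
lemma span_range_eq_top_of_comul_comp_eq_lTensor (T : A →ₗ[k] A)
    (hT : Coalgebra.comul ∘ₗ T = T.lTensor A ∘ₗ Coalgebra.comul) (a : A)
    (ha : Coalgebra.counit (R := k) (T a) = 1) : Ideal.span (Set.range T) = ⊤ := by
  have h1 : ∀ z : A ⊗[k] A, LinearMap.mul' k A
      ((HopfAlgebra.antipode k).rTensor A (T.lTensor A z)) ∈ Ideal.span (Set.range T) := by
    intro z
    induction z using TensorProduct.induction_on with
    | zero => simp
    | tmul x y =>
      simp only [LinearMap.lTensor_tmul, LinearMap.rTensor_tmul, LinearMap.mul'_apply]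
      exact Ideal.mul_mem_left _ _ (Ideal.subset_span ⟨y, rfl⟩)
    | add x y hx hy => simpa only [map_add] using add_mem hx hy
  have h2 := h1 (Coalgebra.comul a)
  rw [← LinearMap.comp_apply (LinearMap.lTensor _ _), ← hT, LinearMap.comp_apply,
    HopfAlgebra.mul_antipode_rTensor_comul_apply, ha, map_one] at h2
  exact (Ideal.eq_top_iff_one _).2 h2

/-- The values of an operator that commutes with right translations and does not vanish identically
at the unit element generate the unit ideal: `1 = ε(T a) = ∑ T(a₁) S(a₂)`. -/
lemma span_range_eq_top_of_comul_comp_eq_rTensor (T : A →ₗ[k] A)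
    (hT : Coalgebra.comul ∘ₗ T = T.rTensor A ∘ₗ Coalgebra.comul) (a : A)
    (ha : Coalgebra.counit (R := k) (T a) = 1) : Ideal.span (Set.range T) = ⊤ := by
  have h1 : ∀ z : A ⊗[k] A, LinearMap.mul' k A
      ((HopfAlgebra.antipode k).lTensor A (T.rTensor A z)) ∈ Ideal.span (Set.range T) := by
    intro z
    induction z using TensorProduct.induction_on with
    | zero => simp
    | tmul x y =>
      simp only [LinearMap.lTensor_tmul, LinearMap.rTensor_tmul, LinearMap.mul'_apply]
      exact Ideal.mul_mem_right _ _ (Ideal.subset_span ⟨x, rfl⟩)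
    | add x y hx hy => simpa only [map_add] using add_mem hx hy
  have h2 := h1 (Coalgebra.comul a)
  rw [← LinearMap.comp_apply (LinearMap.rTensor _ _), ← hT, LinearMap.comp_apply,
    HopfAlgebra.mul_antipode_lTensor_comul_apply, ha, map_one] at h2
  exact (Ideal.eq_top_iff_one _).2 h2

end Averaging

/-! ### Total integrals -/

section TotalIntegral

variable {k A C : Type*} [Field k] [CommRing A] [HopfAlgebra k A] [CommRing C] [HopfAlgebra k C]

/-- The algebra homomorphism `A → A ⊗ C`, `a ↦ ∑ a₁ ⊗ π(a₂)`: for a closed subgroup scheme with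
coordinate algebra `C`, its action by right translations on the functions on the group. -/
def rightCoaction (π : A →ₐc[k] C) : A →ₐ[k] A ⊗[k] C :=
  (Algebra.TensorProduct.map (AlgHom.id k A) (π : A →ₐ[k] C)).comp (Bialgebra.comulAlgHom k A)

lemma regular_res_coact (π : A →ₐc[k] C) (a : A) :
    ((Coaction.regular k A).res π.toCoalgHom).coact a = rightCoaction π a := rfl

/-- The functions on the group that are invariant under right translation by the subgroup scheme
with coordinate algebra `C`. -/
def coinvariants (π : A →ₐc[k] C) : Subalgebra k A :=
  AlgHom.equalizer (rightCoaction π) Algebra.TensorProduct.includeLeft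

lemma mem_coinvariants {π : A →ₐc[k] C} {a : A} :
    a ∈ coinvariants π ↔ rightCoaction π a = a ⊗ₜ 1 := Iff.rfl

/-- A linear functional `t` on a commutative Hopf algebra with `∑ x₁ t(x₂) = t(x)`. -/
def IsIntegralFunctional (t : C →ₗ[k] k) : Prop :=
  ∀ x, slice C t (Coalgebra.comul x) = algebraMap k C (t x)

lemma exists_isIntegralFunctional_ne_zero (k C : Type*) [Field k] [CommRing C] [HopfAlgebra k C]
    [FiniteDimensional k C] : ∃ t : C →ₗ[k] k, IsIntegralFunctional t ∧ t ≠ 0 := by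
  obtain ⟨f, hf⟩ := exists_traceIntegral_ne_zero (k := k) (C := C)
  exact ⟨_, slice_traceIntegral_comul f, hf⟩

/-- `∑ a₁ t(a₂ S(c)) = ∑ t(a S(c₁)) c₂` for an integral `t`. -/
lemma IsIntegralFunctional.slice_comul {t : C →ₗ[k] k} (ht : IsIntegralFunctional t) (a c : C) :
    slice C (t ∘ₗ LinearMap.mulRight k (HopfAlgebra.antipode k c)) (Coalgebra.comul a) =
      TensorProduct.lid k C ((t ∘ₗ LinearMap.mulLeft k a ∘ₗ HopfAlgebra.antipode k).rTensor C
        (Coalgebra.comul c)) := by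
  have h1 : ∀ z : C ⊗[k] C, slice C (t ∘ₗ LinearMap.mulRight k (HopfAlgebra.antipode k c)) z =
      slice C t (z * (1 ⊗ₜ HopfAlgebra.antipode k c)) := by
    intro z
    induction z using TensorProduct.induction_on with
    | zero => simp
    | tmul x y => simp
    | add x y hx hy => simp only [map_add, add_mul, hx, hy]
  have h2 : ∀ (z : C ⊗[k] C) (x : C), slice C t (z * (x ⊗ₜ 1)) = slice C t z * x := by
    intro z x
    induction z using TensorProduct.induction_on with
    | zero => simp
    | tmul x y => simp
    | add x y hx hy => simp only [map_add, add_mul, hx, hy]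
  rw [h1, ← lift_comul_antipode_includeLeft]
  generalize Coalgebra.comul (R := k) c = w
  induction w using TensorProduct.induction_on with
  | zero => simp
  | tmul x y =>
    simp only [Algebra.TensorProduct.lift_tmul, AlgHom.comp_apply, Bialgebra.comulAlgHom_apply,
      HopfAlgebra.antipodeAlgHom, AlgHom.ofLinearMap_apply,
      Algebra.TensorProduct.includeLeft_apply, LinearMap.rTensor_tmul, LinearMap.comp_apply,
      LinearMap.mulLeft_apply, TensorProduct.lid_tmul]
    rw [← mul_assoc, ← Bialgebra.comul_mul, h2, ht, ← Algebra.smul_def]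
  | add x y hx hy => simp only [map_add, mul_add, hx, hy]

/-- The map `c ↦ ∑ t(w₁ S(c)) w₀` attached to a functional `t` on `C` and `w` in `A ⊗ C`. -/
def sliceAntipode (t : C →ₗ[k] k) (w : A ⊗[k] C) : C →ₗ[k] A where
  toFun c := slice A (t ∘ₗ LinearMap.mulRight k (HopfAlgebra.antipode k c)) w
  map_add' x y := by
    induction w using TensorProduct.induction_on with
    | zero => simp
    | tmul a c => simp [mul_add, add_smul]
    | add z w hz hw => rw [map_add, hz, hw, map_add, map_add]; abel
  map_smul' x y := by
    induction w using TensorProduct.induction_on with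
    | zero => simp
    | tmul a c => simp [mul_smul]
    | add z w hz hw => simp only [map_add, hz, hw, smul_add]

/-- An integral on `C` turns every function on the group into a comodule map from `C`. -/
lemma IsIntegralFunctional.rightCoaction_sliceAntipode {t : C →ₗ[k] k}
    (ht : IsIntegralFunctional t) (π : A →ₐc[k] C) (a : A) (c : C) :
    rightCoaction π (sliceAntipode t (rightCoaction π a) c) =
      (sliceAntipode t (rightCoaction π a)).rTensor C (Coalgebra.comul c) := by
  have h1 := ((Coaction.regular k A).res π.toCoalgHom).coact_slice
    (t ∘ₗ LinearMap.mulRight k (HopfAlgebra.antipode k c)) a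
  simp only [regular_res_coact] at h1
  refine h1.trans ?_
  generalize rightCoaction π a = u
  induction u using TensorProduct.induction_on with
  | zero =>
    have : sliceAntipode t (0 : A ⊗[k] C) = 0 := by ext; simp [sliceAntipode]
    simp [this]
  | tmul x y =>
    rw [LinearMap.lTensor_tmul, LinearMap.comp_apply, ht.slice_comul]
    generalize Coalgebra.comul (R := k) c = w
    induction w using TensorProduct.induction_on with
    | zero => simp
    | tmul z v => simp [sliceAntipode, TensorProduct.smul_tmul]
    | add z v hz hv => simp only [map_add, TensorProduct.tmul_add, hz, hv]
  | add x y hx hy =>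
    have : sliceAntipode t (x + y) = sliceAntipode t x + sliceAntipode t y := by
      ext; simp [sliceAntipode]
    rw [map_add, hx, hy, this, LinearMap.rTensor_add, LinearMap.add_apply]

/-- A finite subgroup scheme over whose invariants all functions are integral admits a total
integral, that is, a comodule map `C → A` with `1 ↦ 1`. -/
theorem exists_totalIntegral [FiniteDimensional k C] (π : A →ₐc[k] C)
    (hπ : Function.Surjective π) [Algebra.IsIntegral (coinvariants π) A] :
    ∃ ψ : C →ₗ[k] A, ψ 1 = 1 ∧
      ∀ c, rightCoaction π (ψ c) = ψ.rTensor C (Coalgebra.comul c) := by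
  obtain ⟨t, ht, ht0⟩ := exists_isIntegralFunctional_ne_zero k C
  -- the averaging operator `T` is the value at `1` of the comodule map attached to a function
  let T : A →ₗ[k] A := slice A t ∘ₗ (rightCoaction π).toLinearMap
  have hT : ∀ a, T a = sliceAntipode t (rightCoaction π a) 1 := by
    intro a
    simp [T, sliceAntipode]
  have hmem : ∀ a, T a ∈ coinvariants π := by
    intro a
    rw [mem_coinvariants, hT, ht.rightCoaction_sliceAntipode, Bialgebra.comul_one]
    rfl
  let T' : A →ₗ[coinvariants π] coinvariants π :=
    { toFun a := ⟨T a, hmem a⟩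
      map_add' x y := Subtype.ext (map_add T x y)
      map_smul' b a := by
        ext
        have hb : rightCoaction π b = (b : A) ⊗ₜ[k] (1 : C) := b.2
        have h1 : ∀ z : A ⊗[k] C, slice A t (((b : A) ⊗ₜ[k] (1 : C)) * z) = b * slice A t z := by
          intro z
          induction z using TensorProduct.induction_on with
          | zero => simp
          | tmul x y => simp
          | add x y hx hy => simp only [map_add, mul_add, hx, hy]
        simp [T, Algebra.smul_def, hb, h1] }
  have hcomul : Coalgebra.comul ∘ₗ T = T.lTensor A ∘ₗ Coalgebra.comul := by
    have h1 : T = slice A (t ∘ₗ (π : A →ₐ[k] C).toLinearMap) ∘ₗ Coalgebra.comul := by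
      ext a
      simp only [T, LinearMap.comp_apply, AlgHom.toLinearMap_apply, rightCoaction,
        AlgHom.comp_apply, Bialgebra.comulAlgHom_apply]
      generalize Coalgebra.comul (R := k) a = z
      induction z using TensorProduct.induction_on with
      | zero => simp
      | tmul x y => simp
      | add x y hx hy => simp only [map_add, hx, hy]
    rw [h1]
    ext a
    exact comul_slice_comul _ a
  have hcounit : ∀ a, Coalgebra.counit (R := k) (T a) = t (π a) := by
    intro a
    have h2 : ∀ z : A ⊗[k] A, Coalgebra.counit (R := k) (slice A t
        (Algebra.TensorProduct.map (AlgHom.id k A) (π : A →ₐ[k] C) z)) =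
        t (π (TensorProduct.lid k A (Coalgebra.counit.rTensor A z))) := by
      intro z
      induction z using TensorProduct.induction_on with
      | zero => simp
      | tmul x y => simp [mul_comm]
      | add x y hx hy => simp only [map_add, hx, hy]
    have h3 := h2 (Coalgebra.comul a)
    rw [Coalgebra.rTensor_counit_comul, TensorProduct.lid_tmul, one_smul] at h3
    exact h3
  -- some value of `T` does not vanish at the unit element, as `π` is surjective and `t ≠ 0`
  obtain ⟨c, hc⟩ : ∃ c, t c ≠ 0 := by
    by_contra! h
    exact ht0 (LinearMap.ext h)
  obtain ⟨a, rfl⟩ := hπ c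
  obtain ⟨a', ha'⟩ := exists_apply_eq_one_of_span_range_eq_top (coinvariants π) T'
    (span_range_eq_top_of_comul_comp_eq_lTensor T hcomul ((t (π a))⁻¹ • a)
      (by rw [map_smul, map_smul, hcounit, smul_eq_mul, inv_mul_cancel₀ hc]))
  refine ⟨sliceAntipode t (rightCoaction π a'), ?_, ht.rightCoaction_sliceAntipode π a'⟩
  rw [← hT]
  exact congrArg Subtype.val ha'

end TotalIntegral

/-! ### Relative Hopf modules -/

section RelativeHopfModule

open WithConv

variable {k D V : Type*} [Field k] [CommRing D] [HopfAlgebra k D] [AddCommGroup V] [Module k V]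

/-- The map `v ⊗ d ↦ (c ↦ β(v, S(d) c))`. -/
def antipodeTwist (β : V →ₗ[k] D →ₗ[k] V) : V ⊗[k] D →ₗ[k] D →ₗ[k] V :=
  TensorProduct.lift ((LinearMap.llcomp k D D V ∘ₗ β).compl₂
    (LinearMap.mul k D ∘ₗ HopfAlgebra.antipode k))

@[simp]
lemma antipodeTwist_tmul (β : V →ₗ[k] D →ₗ[k] V) (v : V) (d c : D) :
    antipodeTwist β (v ⊗ₜ d) c = β v (HopfAlgebra.antipode k d * c) := by
  simp [antipodeTwist]

namespace Coaction

/-- The retraction `v ⊗ c ↦ ∑ β(v₀, S(v₁) c)` of the structure map of a comodule. -/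
def retraction (σ : Coaction k D V) (β : V →ₗ[k] D →ₗ[k] V) : V ⊗[k] D →ₗ[k] V :=
  TensorProduct.lift (antipodeTwist β ∘ₗ σ.coact)

lemma rTensor_coact_coact {C : Type*} [AddCommGroup C] [Module k C] [Coalgebra k C]
    (σ : Coaction k C V) (v : V) :
    σ.coact.rTensor C (σ.coact v) =
      (TensorProduct.assoc k V C C).symm (Coalgebra.comul.lTensor V (σ.coact v)) := by
  rw [LinearEquiv.eq_symm_apply]
  exact LinearMap.congr_fun σ.coassoc v

lemma rid_lTensor_counit_coact {C : Type*} [AddCommGroup C] [Module k C] [Coalgebra k C]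
    (σ : Coaction k C V) (v : V) :
    TensorProduct.rid k V (Coalgebra.counit.lTensor V (σ.coact v)) = v :=
  LinearMap.congr_fun σ.counit_coact v

lemma retraction_coact (σ : Coaction k D V) (β : V →ₗ[k] D →ₗ[k] V) (h1 : ∀ v, β v 1 = v) (v : V) :
    σ.retraction β (σ.coact v) = v := by
  have h2 : σ.retraction β = TensorProduct.lift (antipodeTwist β) ∘ₗ σ.coact.rTensor D := by
    ext; simp [retraction]
  have h3 : TensorProduct.lift (antipodeTwist β) ∘ₗ
      (TensorProduct.assoc k V D D).symm.toLinearMap ∘ₗ Coalgebra.comul.lTensor V =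
      (TensorProduct.rid k V).toLinearMap ∘ₗ Coalgebra.counit.lTensor V := by
    ext v d
    have h4 : ∀ z : D ⊗[k] D, TensorProduct.lift (antipodeTwist β)
        ((TensorProduct.assoc k V D D).symm (v ⊗ₜ z)) =
        β v (LinearMap.mul' k D ((HopfAlgebra.antipode k).rTensor D z)) := by
      intro z
      induction z using TensorProduct.induction_on with
      | zero => simp
      | tmul x y => simp
      | add x y hx hy => simp only [map_add, TensorProduct.tmul_add, hx, hy]
    have h5 := h4 (Coalgebra.comul d)
    rw [HopfAlgebra.mul_antipode_rTensor_comul_apply, Algebra.algebraMap_eq_smul_one, map_smul,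
      h1] at h5
    simpa using h5
  rw [h2, LinearMap.comp_apply, rTensor_coact_coact]
  exact (LinearMap.congr_fun h3 _).trans (σ.rid_lTensor_counit_coact v)

/-- If the coaction is compatible with `β`, the retraction is a homomorphism from the cofree
comodule `V ⊗ D`. -/
lemma coact_retraction (σ : Coaction k D V) (β : V →ₗ[k] D →ₗ[k] V)
    (h : ∀ v c, σ.coact (β v c) =
      TensorProduct.map₂ β (LinearMap.mul k D) (σ.coact v) (Coalgebra.comul c)) :
    σ.coact ∘ₗ σ.retraction β = (σ.retraction β).rTensor D ∘ₗ
      (TensorProduct.assoc k V D D).symm.toLinearMap ∘ₗ Coalgebra.comul.lTensor V := by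
  ext v c
  let Q : (V ⊗[k] D) ⊗[k] D →ₗ[k] V ⊗[k] D := TensorProduct.lift
    ((TensorProduct.map₂ β (LinearMap.mul k D)).compl₂
      (Coalgebra.comul ∘ₗ LinearMap.mulRight k c ∘ₗ HopfAlgebra.antipode k))
  -- compatibility, applied with the last factor of `w` moved to the outside by coassociativity
  have hQ : ∀ w : V ⊗[k] D, σ.coact (antipodeTwist β w c) = Q (σ.coact.rTensor D w) := by
    intro w
    induction w using TensorProduct.induction_on with
    | zero => simp
    | tmul x y => simp [Q, h]
    | add x y hx hy => simp only [map_add, LinearMap.add_apply, hx, hy]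
  have hmap : ∀ (v : V) (d : D) (z : D ⊗[k] D),
      TensorProduct.map₂ β (LinearMap.mul k D) (v ⊗ₜ d) z =
        (β v).rTensor D ((1 ⊗ₜ[k] d) * z) := by
    intro v d z
    induction z using TensorProduct.induction_on with
    | zero => simp
    | tmul x y => simp
    | add x y hx hy => simp only [map_add, mul_add, hx, hy]
  have hQ' : ∀ w : V ⊗[k] D, Q ((TensorProduct.assoc k V D D).symm (Coalgebra.comul.lTensor V w)) =
      (antipodeTwist β w).rTensor D (Coalgebra.comul c) := by
    intro w
    induction w using TensorProduct.induction_on with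
    | zero => simp
    | tmul v d =>
      have h1 : ∀ z : D ⊗[k] D, Q ((TensorProduct.assoc k V D D).symm (v ⊗ₜ z)) =
          (β v).rTensor D (Algebra.TensorProduct.lift Algebra.TensorProduct.includeRight
            ((Bialgebra.comulAlgHom k D).comp (HopfAlgebra.antipodeAlgHom k D))
            (fun _ _ => .all _ _) z * Coalgebra.comul c) := by
        intro z
        induction z using TensorProduct.induction_on with
        | zero => simp
        | tmul x y => simp [Q, ← hmap, HopfAlgebra.antipodeAlgHom, mul_assoc]
        | add x y hx hy => simp only [map_add, TensorProduct.tmul_add, add_mul, hx, hy]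
      rw [LinearMap.lTensor_tmul, h1, lift_includeRight_comul_antipode]
      generalize Coalgebra.comul (R := k) c = z
      induction z using TensorProduct.induction_on with
      | zero => simp
      | tmul x y => simp
      | add x y hx hy => simp only [map_add, mul_add, hx, hy]
    | add x y hx hy => simp only [map_add, hx, hy, LinearMap.rTensor_add, LinearMap.add_apply]
  have h2 : ∀ z : D ⊗[k] D, (σ.retraction β).rTensor D ((TensorProduct.assoc k V D D).symm
      (v ⊗ₜ z)) = (antipodeTwist β (σ.coact v)).rTensor D z := by
    intro z
    induction z using TensorProduct.induction_on with
    | zero => simp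
    | tmul x y => simp [retraction]
    | add x y hx hy => simp only [map_add, TensorProduct.tmul_add, hx, hy]
  have h3 : σ.retraction β (v ⊗ₜ c) = antipodeTwist β (σ.coact v) c := by simp [retraction]
  simp only [TensorProduct.AlgebraTensorModule.curry_apply, LinearMap.restrictScalars_self,
    TensorProduct.curry_apply, LinearMap.comp_apply, LinearEquiv.coe_coe, LinearMap.lTensor_tmul]
  rw [h2, h3, hQ, rTensor_coact_coact, hQ']

/-- A comodule `V` with a compatible `β : V × D → V` such that `β(v, 1) = v` is injective, being a
retract of the cofree comodule `V ⊗ D`.  For a module over a comodule algebra with a total integral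
`φ`, the map `β(v, c) = φ(c) v` is of this kind. -/
theorem isInjective_of_compatible {k D V : Type u} [Field k] [CommRing D] [HopfAlgebra k D]
    [AddCommGroup V] [Module k V] (σ : Coaction k D V) (β : V →ₗ[k] D →ₗ[k] V)
    (h1 : ∀ v, β v 1 = v)
    (h : ∀ v c, σ.coact (β v c) =
      TensorProduct.map₂ β (LinearMap.mul k D) (σ.coact v) (Coalgebra.comul c)) :
    σ.IsInjective := by
  intro X Y _ _ _ _ σX σY i f hi hinj hf
  obtain ⟨j, hj⟩ := i.exists_leftInverse_of_injective (LinearMap.ker_eq_bot.2 hinj)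
  refine ⟨σ.retraction β ∘ₗ (f ∘ₗ j).rTensor D ∘ₗ σY.coact, ?_, ?_⟩
  · ext y
    have h2 := LinearMap.congr_fun (σ.coact_retraction β h) ((f ∘ₗ j).rTensor D (σY.coact y))
    simp only [LinearMap.comp_apply, LinearEquiv.coe_coe] at h2
    have h3 : (TensorProduct.assoc k V D D).symm.toLinearMap ∘ₗ Coalgebra.comul.lTensor V ∘ₗ
        (f ∘ₗ j).rTensor D = ((f ∘ₗ j).rTensor D).rTensor D ∘ₗ
        (TensorProduct.assoc k Y D D).symm.toLinearMap ∘ₗ Coalgebra.comul.lTensor Y := by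
      ext y d
      simp only [TensorProduct.AlgebraTensorModule.curry_apply, LinearMap.restrictScalars_self,
        TensorProduct.curry_apply, LinearMap.comp_apply, LinearEquiv.coe_coe,
        LinearMap.lTensor_tmul, LinearMap.rTensor_tmul]
      induction Coalgebra.comul (R := k) d using TensorProduct.induction_on with
      | zero => simp
      | tmul x y => simp
      | add x y hx hy => simp only [map_add, TensorProduct.tmul_add, hx, hy]
    have h4 := LinearMap.congr_fun h3 (σY.coact y)
    simp only [LinearMap.comp_apply, LinearEquiv.coe_coe] at h4
    simp only [LinearMap.comp_apply, LinearMap.rTensor_comp] at h2 h4 ⊢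
    rw [h2, h4, ← rTensor_coact_coact]
  · ext x
    have h2 := LinearMap.congr_fun hi x
    have h3 := LinearMap.congr_fun hf x
    simp only [LinearMap.comp_apply] at h2 h3 ⊢
    rw [h2, ← LinearMap.rTensor_comp_apply, LinearMap.comp_assoc, hj, LinearMap.comp_id, ← h3,
      retraction_coact σ β h1]

end Coaction

end RelativeHopfModule

/-! ### The Lang map -/

section LangMap

open WithConv Algebra.TensorProduct

variable {k A C : Type*} [Field k] [CommRing A] [HopfAlgebra k A] [CommRing C] [HopfAlgebra k C]

lemma map_comp_comulAlgHom {D E : Type*} [CommRing D] [Algebra k D] [CommRing E] [Algebra k E]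
    (f : A →ₐ[k] D) (g : A →ₐ[k] E) :
    (map f g).comp (Bialgebra.comulAlgHom k A) =
      (toConv (includeLeft.comp f) * toConv (includeRight.comp g) :
        WithConv (A →ₐ[k] D ⊗[k] E)).ofConv := by
  rw [AlgHom.convMul_def, ofConv_toConv, ← AlgHom.comp_assoc]
  congr 1
  ext <;> simp

/-- Left translation by a rational point as a convolution product of algebra homomorphisms. -/
lemma leftTranslate_eq_convMul (g : WithConv (A →ₐ[k] k)) :
    leftTranslate g = (toConv ((Algebra.ofId k A).comp g.ofConv) * toConv (AlgHom.id k A) :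
      WithConv (A →ₐ[k] A)).ofConv.toLinearMap := by
  ext a
  refine Eq.trans ?_ (AlgHom.convMul_apply _ _ a).symm
  simp only [leftTranslate, LinearMap.comp_apply, LinearEquiv.coe_coe]
  generalize Coalgebra.comul (R := k) a = z
  induction z using TensorProduct.induction_on with
  | zero => simp
  | tmul x y => simp [Algebra.ofId_apply, Algebra.smul_def]
  | add x y hx hy => simp only [map_add, hx, hy]

lemma leftTranslate_mul (g : WithConv (A →ₐ[k] k)) (a b : A) :
    leftTranslate g (a * b) = leftTranslate g a * leftTranslate g b := by
  simp [leftTranslate_eq_convMul]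

/-- The Lang map `x ↦ F(x)⁻¹ x` of an endomorphism `F` of a group scheme, on coordinate
algebras. -/
def langMap (F : A →ₐc[k] A) : A →ₐ[k] A :=
  ((toConv (F : A →ₐ[k] A))⁻¹ * toConv (AlgHom.id k A) : WithConv (A →ₐ[k] A)).ofConv

lemma comp_langMap {B : Type*} [CommRing B] [Bialgebra k B] (θ : A →ₐ[k] B) (F : A →ₐc[k] A) :
    θ.comp (langMap F) = ((toConv (θ.comp (F : A →ₐ[k] A)))⁻¹ * toConv θ :
      WithConv (A →ₐ[k] B)).ofConv :=
  AlgHom.comp_convMul_distrib θ _ _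

/-- The Lang map is invariant under left translation by the fixed points of `F`. -/
lemma leftTranslate_langMap (F : A →ₐc[k] A) (g : WithConv (A →ₐ[k] k))
    (hg : g.ofConv.comp (F : A →ₐ[k] A) = g.ofConv) (a : A) :
    leftTranslate g (langMap F a) = langMap F a := by
  rw [leftTranslate_eq_convMul]
  set γ : WithConv (A →ₐ[k] A) := toConv ((Algebra.ofId k A).comp g.ofConv) with hγ
  -- translation by a fixed point of `F`, followed by `F`, is `F` followed by the same translation
  have h1 : toConv ((γ * toConv (AlgHom.id k A)).ofConv.comp (F : A →ₐ[k] A)) =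
      γ * toConv (F : A →ₐ[k] A) := by
    rw [AlgHom.convMul_comp_bialgHom_distrib, toConv_ofConv, hγ, ofConv_toConv, AlgHom.comp_assoc,
      hg, ofConv_toConv, AlgHom.id_comp]
  have h2 := comp_langMap (γ * toConv (AlgHom.id k A)).ofConv F
  rw [h1, toConv_ofConv, mul_inv_rev, mul_assoc, inv_mul_cancel_left] at h2
  exact AlgHom.congr_fun h2 a

/-- The Lang map is equivariant for right translations by a subgroup scheme on which `F` is
trivial. -/
lemma rightCoaction_langMap (π : A →ₐc[k] C) (F : A →ₐc[k] A)
    (hF : ∀ a, π (F a) = algebraMap k C (Coalgebra.counit a)) (a : A) :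
    rightCoaction π (langMap F a) = (langMap F).toLinearMap.rTensor C (rightCoaction π a) := by
  have h1 : toConv ((rightCoaction π).comp (F : A →ₐ[k] A)) =
      toConv (includeLeft.comp (F : A →ₐ[k] A)) := by
    have h2 : toConv ((includeRight.comp (π : A →ₐ[k] C)).comp (F : A →ₐ[k] A)) =
        (1 : WithConv (A →ₐ[k] A ⊗[k] C)) := by
      apply ofConv_injective
      ext x
      have : π (F x) = algebraMap k C (Coalgebra.counit x) := hF x
      simp [this, AlgHom.convOne_def, Algebra.ofId_apply]
    rw [rightCoaction, map_comp_comulAlgHom, AlgHom.convMul_comp_bialgHom_distrib, toConv_ofConv,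
      ofConv_toConv, ofConv_toConv, h2, mul_one, AlgHom.comp_id]
  have h3 := comp_langMap (rightCoaction π) F
  have h4 : (rightCoaction π).comp (langMap F) =
      (map (langMap F) (π : A →ₐ[k] C)).comp (Bialgebra.comulAlgHom k A) := by
    rw [h3, h1, map_comp_comulAlgHom, comp_langMap, toConv_ofConv, rightCoaction,
      map_comp_comulAlgHom, toConv_ofConv, AlgHom.comp_id, mul_assoc]
  refine (AlgHom.congr_fun h4 a).trans ?_
  simp only [rightCoaction, AlgHom.comp_apply]
  generalize Bialgebra.comulAlgHom k A a = z
  induction z using TensorProduct.induction_on with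
  | zero => simp
  | tmul x y => simp
  | add x y hx hy => simp only [map_add, hx, hy]

end LangMap

/-! ### Restriction of induced modules to infinitesimal subgroups -/

section InducedMock

/-- Let `C` be the coordinate algebra of a finite subgroup scheme on which an endomorphism `F` of
the group scheme is trivial.  A module induced from a group of fixed points of `F` is injective over
this subgroup scheme: pulling back a total integral along the Lang map gives one with values
in the functions invariant under left translation by the fixed points, and these act on the induced
module. -/
theorem ind_res_isInjective {k A C M : Type u} {Γ : Type*} [Field k] [CommRing A] [HopfAlgebra k A]
    [CommRing C] [HopfAlgebra k C] [FiniteDimensional k C] [Group Γ] [AddCommGroup M] [Module k M]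
    (π : A →ₐc[k] C) (hπ : Function.Surjective π) [Algebra.IsIntegral (coinvariants π) A]
    (F : A →ₐc[k] A) (hF : ∀ a, π (F a) = algebraMap k C (Coalgebra.counit a))
    (ι : Γ →* WithConv (A →ₐ[k] k)) (hι : ∀ g, (ι g).ofConv.comp (F : A →ₐ[k] A) = (ι g).ofConv)
    (ρ : Representation k Γ M) : ((ind ι ρ).res π.toCoalgHom).IsInjective := by
  obtain ⟨ψ, hψ1, hψ⟩ := exists_totalIntegral π hπ
  let φ : C →ₗ[k] A := (langMap F).toLinearMap ∘ₗ ψ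
  have hφ : ∀ c, rightCoaction π (φ c) = φ.rTensor C (Coalgebra.comul c) := by
    intro c
    simp only [φ, LinearMap.comp_apply, AlgHom.toLinearMap_apply]
    rw [rightCoaction_langMap π F hF, hψ, ← LinearMap.rTensor_comp_apply]
  have hφinv : ∀ g c, leftTranslate (ι g) (φ c) = φ c := fun g c =>
    leftTranslate_langMap F (ι g) (hι g) _
  -- multiplication of `M`-valued functions by functions; its restriction to the values of `φ`
  -- preserves the induced module
  let β₀ : M ⊗[k] A →ₗ[k] A →ₗ[k] M ⊗[k] A := (LinearMap.lTensorHom M ∘ₗ LinearMap.mul k A).flip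
  have hβ₀ : ∀ m a b, β₀ (m ⊗ₜ a) b = m ⊗ₜ (b * a) := fun m a b => rfl
  have hmem : ∀ x ∈ indSubmodule ι ρ, ∀ c, β₀ x (φ c) ∈ indSubmodule ι ρ := by
    intro x hx c
    simp only [indSubmodule, Submodule.mem_iInf, LinearMap.mem_eqLocus] at hx ⊢
    intro g
    have h1 : ∀ y : M ⊗[k] A, (ρ g).rTensor A (β₀ y (φ c)) = β₀ ((ρ g).rTensor A y) (φ c) := by
      intro y
      induction y using TensorProduct.induction_on with
      | zero => simp
      | tmul m a => simp [hβ₀]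
      | add y z hy hz => simp only [map_add, LinearMap.add_apply, hy, hz]
    have h2 : ∀ y : M ⊗[k] A, (leftTranslate (ι g)).lTensor M (β₀ y (φ c)) =
        β₀ ((leftTranslate (ι g)).lTensor M y) (φ c) := by
      intro y
      induction y using TensorProduct.induction_on with
      | zero => simp
      | tmul m a => simp [hβ₀, leftTranslate_mul, hφinv]
      | add y z hy hz => simp only [map_add, LinearMap.add_apply, hy, hz]
    rw [h1, h2, hx]
  let β : indSubmodule ι ρ →ₗ[k] C →ₗ[k] indSubmodule ι ρ :=
    LinearMap.mk₂ k (fun x c => ⟨β₀ x (φ c), hmem x x.2 c⟩)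
      (fun x y c => Subtype.ext (by simp)) (fun a x c => Subtype.ext (by simp))
      (fun x c d => Subtype.ext (by simp)) (fun a x c => Subtype.ext (by simp))
  refine Coaction.isInjective_of_compatible _ β ?_ ?_
  · intro x
    ext
    have h1 : φ 1 = 1 := by simp [φ, hψ1]
    have h2 : ∀ y : M ⊗[k] A, β₀ y 1 = y := by
      intro y
      induction y using TensorProduct.induction_on with
      | zero => simp
      | tmul m a => simp [hβ₀]
      | add y z hy hz => simp only [map_add, LinearMap.add_apply, hy, hz]
    simp [β, h1, h2]
  · intro x c
    apply Module.Flat.rTensor_preserves_injective_linearMap (M := C) (indSubmodule ι ρ).subtype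
      (Submodule.subtype_injective _)
    -- the coaction of `C` on all regular functions with values in `M`
    let δ : M ⊗[k] A →ₗ[k] (M ⊗[k] A) ⊗[k] C :=
      (π : A →ₐ[k] C).toLinearMap.lTensor (M ⊗[k] A) ∘ₗ rightRegular k A M
    have hδ : ∀ m a, δ (m ⊗ₜ a) = (TensorProduct.assoc k M A C).symm (m ⊗ₜ rightCoaction π a) := by
      intro m a
      simp only [δ, rightRegular, rightCoaction, LinearMap.comp_apply, LinearEquiv.coe_coe,
        LinearMap.lTensor_tmul, AlgHom.comp_apply, Bialgebra.comulAlgHom_apply]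
      generalize Coalgebra.comul (R := k) a = z
      induction z using TensorProduct.induction_on with
      | zero => simp
      | tmul x y => simp
      | add x y hx hy => simp only [map_add, TensorProduct.tmul_add, hx, hy]
    have h1 : ∀ x : indSubmodule ι ρ, (indSubmodule ι ρ).subtype.rTensor C
        (((ind ι ρ).res π.toCoalgHom).coact x) = δ x := by
      intro x
      have h2 := LinearMap.congr_fun (rTensor_subtype_indCoact ι ρ) x
      simp only [LinearMap.comp_apply, Submodule.subtype_apply] at h2
      simp only [δ, LinearMap.comp_apply]
      rw [← h2, ← LinearMap.comp_apply (LinearMap.lTensor _ _), LinearMap.lTensor_comp_rTensor,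
        ← LinearMap.rTensor_comp_lTensor]
      rfl
    have h3 : ∀ (z : indSubmodule ι ρ ⊗[k] C) (w : C ⊗[k] C),
        (indSubmodule ι ρ).subtype.rTensor C (TensorProduct.map₂ β (LinearMap.mul k C) z w) =
        TensorProduct.map₂ (β₀.compl₂ φ) (LinearMap.mul k C)
          ((indSubmodule ι ρ).subtype.rTensor C z) w := by
      intro z w
      induction z using TensorProduct.induction_on with
      | zero => simp
      | tmul x d =>
        induction w using TensorProduct.induction_on with
        | zero => simp
        | tmul c e => simp [β]
        | add w v hw hv => simp only [map_add, hw, hv]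
      | add y z hy hz => simp only [map_add, LinearMap.add_apply, hy, hz]
    have h4 : ∀ y : M ⊗[k] A, δ (β₀ y (φ c)) = TensorProduct.map₂ (β₀.compl₂ φ)
        (LinearMap.mul k C) (δ y) (Coalgebra.comul c) := by
      intro y
      induction y using TensorProduct.induction_on with
      | zero => simp
      | tmul m a =>
        rw [hβ₀, hδ, hδ, map_mul, hφ]
        generalize Coalgebra.comul (R := k) c = w
        generalize rightCoaction π a = z
        induction z using TensorProduct.induction_on with
        | zero => simp
        | tmul b d =>
          induction w using TensorProduct.induction_on with
          | zero => simp
          | tmul c e => simp [hβ₀, mul_comm d e]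
          | add w v hw hv => simp only [map_add, add_mul, TensorProduct.tmul_add, hw, hv]
        | add y z hy hz =>
          simp only [map_add, mul_add, TensorProduct.tmul_add, LinearMap.add_apply, hy, hz]
      | add y z hy hz => simp only [map_add, LinearMap.add_apply, hy, hz]
    rw [h1, h3, h1]
    exact h4 x

end InducedMock

/-! ### Finiteness and integrality for Frobenius kernels -/

section Frobenius

variable {k : Type*} [Field k] {p : ℕ} [Fact p.Prime]

lemma frobeniusKernel_mk_pow {A : Type*} [CommRing A] [HopfAlgebra k A] [CharP k p] (s : ℕ)
    (x : A ⧸ frobeniusKernelIdeal k A p s) :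
    ∃ c : k, x ^ p ^ s = algebraMap k _ c := by
  obtain ⟨a, rfl⟩ := Ideal.Quotient.mk_surjective x
  exact ⟨_, by rw [← map_pow, mk_pow_eq_of_frobeniusKernelIdeal]⟩

instance finiteDimensional_frobeniusKernel {A : Type*} [CommRing A] [HopfAlgebra k A] [CharP k p]
    [Algebra.FiniteType k A] (s : ℕ) : FiniteDimensional k (A ⧸ frobeniusKernelIdeal k A p s) := by
  have : Algebra.IsIntegral k (A ⧸ frobeniusKernelIdeal k A p s) := ⟨fun x => by
    obtain ⟨c, hc⟩ := frobeniusKernel_mk_pow s x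
    exact .of_pow (pow_pos (Fact.out (p := p.Prime)).pos s) (hc ▸ isIntegral_algebraMap)⟩
  have : Algebra.FiniteType k (A ⧸ frobeniusKernelIdeal k A p s) :=
    .of_surjective (Ideal.Quotient.mkₐ k _) (Ideal.Quotient.mkₐ_surjective _ _)
  exact Algebra.IsIntegral.finite

/-- All functions are integral over the functions invariant under a Frobenius kernel, as these
include all `p ^ s`-th powers. -/
instance isIntegral_coinvariants_frobeniusKernel {A : Type*} [CommRing A] [HopfAlgebra k A]
    [CharP k p] (s : ℕ) : Algebra.IsIntegral (coinvariants
      (Bialgebra.Quotient.mkBialgHom (R := k) (frobeniusKernelIdeal k A p s))) A := by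
  refine ⟨fun a => .of_pow (pow_pos (Fact.out (p := p.Prime)).pos s) ?_⟩
  have : Nontrivial A := (Bialgebra.counitAlgHom k A).toRingHom.domain_nontrivial
  have : CharP (A ⊗[k] A) p := by
    have : Nontrivial (A ⊗[k] A) :=
      (Algebra.TensorProduct.lift (Bialgebra.counitAlgHom k A)
        (Bialgebra.counitAlgHom k A) (fun _ _ => .all _ _)).toRingHom.domain_nontrivial
    exact charP_of_injective_algebraMap (algebraMap k _).injective p
  set π := Bialgebra.Quotient.mkBialgHom (R := k) (frobeniusKernelIdeal k A p s)
  have hmk : ∀ x : A, π (x ^ p ^ s) = algebraMap k _ (Coalgebra.counit (R := k) x ^ p ^ s) :=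
    mk_pow_eq_of_frobeniusKernelIdeal
  suffices h : a ^ p ^ s ∈ coinvariants π from
    isIntegral_algebraMap (R := coinvariants π) (x := ⟨_, h⟩)
  rw [mem_coinvariants, rightCoaction, AlgHom.comp_apply, map_pow, map_pow, ← map_pow]
  -- the `p ^ s`-th power map is additive and `π (y ^ p ^ s)` is the scalar `ε(y) ^ p ^ s`
  have h1 : ∀ z : A ⊗[k] A, Algebra.TensorProduct.map (AlgHom.id k A)
      (π : A →ₐ[k] A ⧸ frobeniusKernelIdeal k A p s) (z ^ p ^ s) =
      ((TensorProduct.rid k A (Coalgebra.counit.lTensor A z)) ^ p ^ s) ⊗ₜ[k] 1 := by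
    intro z
    have : CharP A p := charP_of_injective_algebraMap (algebraMap k A).injective p
    induction z using TensorProduct.induction_on with
    | zero => simp [(Fact.out (p := p.Prime)).ne_zero]
    | tmul x y =>
      have h2 : (π : A →ₐ[k] A ⧸ frobeniusKernelIdeal k A p s) (y ^ p ^ s) = _ := hmk y
      rw [Algebra.TensorProduct.tmul_pow, Algebra.TensorProduct.map_tmul, h2,
        Algebra.algebraMap_eq_smul_one, TensorProduct.tmul_smul]
      simp [smul_pow, TensorProduct.smul_tmul']
    | add x y hx hy =>
      rw [add_pow_char_pow, map_add, hx, hy, map_add, map_add, add_pow_char_pow,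
        TensorProduct.add_tmul]
  rw [h1, Bialgebra.comulAlgHom_apply, Coalgebra.lTensor_counit_comul]
  simp

end Frobenius

/-! ### The Frobenius endomorphism of a group over the prime field -/

section FrobeniusEndomorphism

variable (p : ℕ) [Fact p.Prime] (k R : Type*) [Field k] [Algebra (ZMod p) k] [CommRing R]
  [HopfAlgebra (ZMod p) R]

lemma frobeniusAlgHom_pow_apply (S : Type*) [CommRing S] [Algebra (ZMod p) S] (n : ℕ) (x : S) :
    (FiniteField.frobeniusAlgHom (ZMod p) S ^ n) x = x ^ p ^ n := by
  rw [AlgHom.coe_pow, FiniteField.coe_frobeniusAlgHom, pow_iterate, ZMod.card]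

/-- The `n`-th power of the Frobenius endomorphism of an affine group scheme over the prime
field. -/
def iterateFrobeniusBialgHom (n : ℕ) : R →ₐc[ZMod p] R :=
  BialgHom.ofAlgHom (FiniteField.frobeniusAlgHom (ZMod p) R ^ n)
    (by
      ext x
      simp only [AlgHom.comp_apply, frobeniusAlgHom_pow_apply, map_pow]
      exact ZMod.pow_card_pow _)
    (by
      ext x
      have h1 : ∀ z : R ⊗[ZMod p] R, Algebra.TensorProduct.map
          (FiniteField.frobeniusAlgHom (ZMod p) R ^ n)
          (FiniteField.frobeniusAlgHom (ZMod p) R ^ n) z =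
          (FiniteField.frobeniusAlgHom (ZMod p) (R ⊗[ZMod p] R) ^ n) z := by
        intro z
        induction z using TensorProduct.induction_on with
        | zero => simp
        | tmul x y => simp [frobeniusAlgHom_pow_apply]
        | add x y hx hy => simp only [map_add, hx, hy]
      simp only [AlgHom.comp_apply, h1, frobeniusAlgHom_pow_apply, map_pow])

/-- The `n`-th power of the Frobenius endomorphism `F` of the base change to `k` of an affine group
scheme over the prime field. -/
def frobeniusEndomorphism (n : ℕ) : k ⊗[ZMod p] R →ₐc[k] k ⊗[ZMod p] R :=
  Bialgebra.TensorProduct.map (BialgHom.id k k) (iterateFrobeniusBialgHom p R n)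

lemma frobeniusEndomorphism_tmul (n : ℕ) (a : k) (x : R) :
    frobeniusEndomorphism p k R n (a ⊗ₜ x) = a ⊗ₜ (x ^ p ^ n) := by
  have : iterateFrobeniusBialgHom p R n x = x ^ p ^ n := frobeniusAlgHom_pow_apply p R n x
  simp [frobeniusEndomorphism, this]

variable {p k R}

/-- `F ^ n` is trivial on the `s`-th Frobenius kernel for `s ≤ n`. -/
lemma mkBialgHom_frobeniusEndomorphism [CharP k p] {s n : ℕ} (hs : s ≤ n) (a : k ⊗[ZMod p] R) :
    Bialgebra.Quotient.mkBialgHom (R := k) (frobeniusKernelIdeal k (k ⊗[ZMod p] R) p s)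
      (frobeniusEndomorphism p k R n a) = algebraMap k _ (Coalgebra.counit a) := by
  set π := Bialgebra.Quotient.mkBialgHom (R := k) (frobeniusKernelIdeal k (k ⊗[ZMod p] R) p s)
  have hmk : ∀ x, π (x ^ p ^ s) = algebraMap k _ (Coalgebra.counit (R := k) x ^ p ^ s) :=
    mk_pow_eq_of_frobeniusKernelIdeal
  induction a using TensorProduct.induction_on with
  | zero => simp
  | tmul a x =>
    obtain ⟨m, rfl⟩ := Nat.exists_eq_add_of_le hs
    have h1 : a ⊗ₜ[ZMod p] (x ^ p ^ (s + m)) =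
        a • ((1 ⊗ₜ[ZMod p] x : k ⊗[ZMod p] R) ^ p ^ s) ^ p ^ m := by
      rw [← pow_mul, ← pow_add, Algebra.TensorProduct.tmul_pow, one_pow, TensorProduct.smul_tmul',
        smul_eq_mul, mul_one]
    have h2 : (Coalgebra.counit (R := k) (1 ⊗ₜ[ZMod p] x : k ⊗[ZMod p] R)) =
        algebraMap (ZMod p) k (Coalgebra.counit x) := by
      simp [Algebra.algebraMap_eq_smul_one]
    have h3 : (Coalgebra.counit (R := k) (a ⊗ₜ[ZMod p] x : k ⊗[ZMod p] R)) =
        a * algebraMap (ZMod p) k (Coalgebra.counit x) := by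
      simp [Algebra.algebraMap_eq_smul_one]
    rw [frobeniusEndomorphism_tmul, h1, map_smul, map_pow, hmk, h2, h3, ← map_pow, ← map_pow,
      ← map_pow, ← pow_mul, ← pow_add, ZMod.pow_card_pow, map_mul, Algebra.smul_def]
  | add x y hx hy => simp only [map_add, hx, hy]

/-- The points of `G` over the field with `p ^ r` elements are fixed by the powers of `F ^ r`. -/
lemma comp_frobeniusEndomorphism_of_mem_rationalPoints {r : ℕ} [Algebra (GaloisField p r) k]
    (hr : r ≠ 0) (g : WithConv ((k ⊗[ZMod p] R) →ₐ[k] k))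
    (hg : g ∈ rationalPoints p k (GaloisField p r) R) (s : ℕ) :
    g.ofConv.comp (frobeniusEndomorphism p k R (r * s) : k ⊗[ZMod p] R →ₐ[k] k ⊗[ZMod p] R) =
      g.ofConv := by
  obtain ⟨g₀, hg₀⟩ := hg
  have := Fintype.ofFinite (GaloisField p r)
  have hcard : Fintype.card (GaloisField p r) = p ^ r := by
    rw [← Nat.card_eq_fintype_card, GaloisField.card p r hr]
  apply Algebra.TensorProduct.ext (by ext)
  ext x
  have h1 : frobeniusEndomorphism p k R (r * s) ((1 : k) ⊗ₜ x) = (1 ⊗ₜ x) ^ p ^ (r * s) := by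
    rw [frobeniusEndomorphism_tmul, Algebra.TensorProduct.tmul_pow, one_pow]
  have h2 : g.ofConv (frobeniusEndomorphism p k R (r * s) ((1 : k) ⊗ₜ x)) =
      g.ofConv (1 ⊗ₜ x) := by
    rw [h1, map_pow, hg₀, ← map_pow, pow_mul, ← hcard, FiniteField.pow_card_pow]
  exact h2

/-- A group of finite type over `k` has finitely many points over a finite field. -/
lemma finite_rationalPoints {r : ℕ} [Algebra (GaloisField p r) k]
    [Algebra.FiniteType k (k ⊗[ZMod p] R)] : (rationalPoints p k (GaloisField p r) R).Finite := by
  obtain ⟨S, hS⟩ := Algebra.FiniteType.out (R := k) (A := k ⊗[ZMod p] R)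
  classical
  obtain ⟨T, hT⟩ : ∃ T : Finset R, Algebra.adjoin k
      ((fun x : R => (1 : k) ⊗ₜ[ZMod p] x) '' T) = ⊤ := by
    have h1 : ∀ a : k ⊗[ZMod p] R, ∃ T : Finset R, a ∈ Algebra.adjoin k
        ((fun x : R => (1 : k) ⊗ₜ[ZMod p] x) '' T) := by
      intro a
      induction a using TensorProduct.induction_on with
      | zero => exact ⟨∅, zero_mem _⟩
      | tmul c x =>
        refine ⟨{x}, ?_⟩
        have : c ⊗ₜ[ZMod p] x = c • ((1 : k) ⊗ₜ[ZMod p] x) := by simp [TensorProduct.smul_tmul']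
        rw [this]
        exact Subalgebra.smul_mem _ (Algebra.subset_adjoin (by simp)) c
      | add a b ha hb =>
        obtain ⟨T, hT⟩ := ha
        obtain ⟨T', hT'⟩ := hb
        exact ⟨T ∪ T', add_mem
          (Algebra.adjoin_mono (Set.image_mono (by simp)) hT)
          (Algebra.adjoin_mono (Set.image_mono (by simp)) hT')⟩
    choose T hT using h1
    refine ⟨S.biUnion T, ?_⟩
    rw [← top_le_iff, ← hS]
    refine Algebra.adjoin_le fun a ha => Algebra.adjoin_mono (Set.image_mono ?_) (hT a)
    exact Finset.coe_subset.2 (Finset.subset_biUnion_of_mem T ha)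
  -- a point is determined by its values on finitely many `1 ⊗ x`, which lie in the finite field
  let f : WithConv ((k ⊗[ZMod p] R) →ₐ[k] k) → (T → k) := fun g x => g.ofConv (1 ⊗ₜ x.1)
  have hf : Function.Injective f := by
    intro g g' h
    apply WithConv.ofConv_injective
    refine AlgHom.ext_of_adjoin_eq_top hT ?_
    rintro _ ⟨x, hx, rfl⟩
    exact congrFun h ⟨x, hx⟩
  refine Set.Finite.of_finite_image (f := f) ?_ hf.injOn
  refine (Set.Finite.pi' (t := fun _ => Set.range (algebraMap (GaloisField p r) k))
    fun _ => Set.finite_range _).subset ?_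
  rintro _ ⟨g, ⟨g₀, hg₀⟩, rfl⟩ x
  exact ⟨g₀ x, (hg₀ x).symm⟩

end FrobeniusEndomorphism

/-- Modules induced from a group of points over a finite field are mock injective. -/
theorem ind_isMockInjective {k : Type u} [Field k] {p r : ℕ} [Fact p.Prime] [CharP k p]
    [Algebra (ZMod p) k] (hr : 0 < r) [Algebra (GaloisField p r) k]
    {R : Type u} [CommRing R] [HopfAlgebra (ZMod p) R] [Algebra.FiniteType k (k ⊗[ZMod p] R)]
    (H : Subgroup (WithConv ((k ⊗[ZMod p] R) →ₐ[k] k)))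
    (hH : (H : Set (WithConv ((k ⊗[ZMod p] R) →ₐ[k] k))) ⊆
      rationalPoints p k (GaloisField p r) R)
    {M : Type u} [AddCommGroup M] [Module k M] (ρ : Representation k H M) :
    (ind H.subtype ρ).IsMockInjective p := by
  intro s _
  -- `r * s` is a multiple of `r` and at least `s`
  exact ind_res_isInjective _ Ideal.Quotient.mk_surjective (frobeniusEndomorphism p k R (r * s))
    (mkBialgHom_frobeniusEndomorphism (Nat.le_mul_of_pos_left s hr)) H.subtype
    (fun h => comp_frobeniusEndomorphism_of_mem_rationalPoints hr.ne' _ (hH h.2) s) ρ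

/-! ### Injectivity is detected by extensions of simple modules -/

section SimpleLift

/-- Let `M` be a submodule of an injective module `E` over an Artinian ring.  If homomorphisms from
simple modules to `E / M` lift to `E`, that is, if simple modules have no nontrivial extensions by
`M`, then `M` is injective. -/
theorem Module.injective_of_forall_simple_lift {R : Type u} [Ring R] [IsNoetherianRing R]
    [IsArtinianRing R] {M E : Type u} [AddCommGroup M] [Module R M] [AddCommGroup E] [Module R E]
    [Module.Injective R E] (j : M →ₗ[R] E) (hj : Function.Injective j)
    (hS : ∀ (S : Type u) [AddCommGroup S] [Module R S] [IsSimpleModule R S]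
      (v : S →ₗ[R] E ⧸ LinearMap.range j), ∃ v' : S →ₗ[R] E, (LinearMap.range j).mkQ ∘ₗ v' = v) :
    Module.Injective R M := by
  refine Module.Baer.injective fun I g => ?_
  let P : Set (Ideal R) := {J | ∃ (hIJ : I ≤ J) (g' : J →ₗ[R] M),
    ∀ x (hx : x ∈ I), g' ⟨x, hIJ hx⟩ = g ⟨x, hx⟩}
  obtain ⟨J, ⟨hIJ, g', hg'⟩, hmax⟩ := set_has_maximal_iff_noetherian.2
    (inferInstance : IsNoetherian R R) P ⟨I, le_rfl, g, fun _ _ => rfl⟩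
  by_cases hJ : J = ⊤
  · subst hJ
    exact ⟨g' ∘ₗ Submodule.topEquiv.symm.toLinearMap, fun x hx => hg' x hx⟩
  · exfalso
    obtain ⟨J', hJ'⟩ := exists_covBy_of_wellFoundedLT (mt isMax_iff_eq_top.1 hJ)
    have hsimple := (covBy_iff_quot_is_simple hJ'.le).1 hJ'
    obtain ⟨G, hG⟩ := Module.Injective.out J.subtype J.subtype_injective (j ∘ₗ g')
    set K := Submodule.comap J'.subtype J
    -- the obstruction to extending `g'` from `J` to `J'`
    let v : (J' ⧸ K) →ₗ[R] E ⧸ LinearMap.range j :=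
      K.liftQ ((LinearMap.range j).mkQ ∘ₗ G ∘ₗ J'.subtype) (by
        intro x hx
        rw [LinearMap.mem_ker, LinearMap.comp_apply, Submodule.mkQ_apply,
          Submodule.Quotient.mk_eq_zero]
        exact ⟨g' ⟨x, hx⟩, (hG ⟨x, hx⟩).symm⟩)
    obtain ⟨v', hv'⟩ := hS _ v
    -- `G` corrected by a lift of the obstruction takes values in `M` and still extends `g'`
    let w : J' →ₗ[R] E := G ∘ₗ J'.subtype - v' ∘ₗ K.mkQ
    have hw : ∀ x, w x ∈ LinearMap.range j := by
      intro x
      rw [← Submodule.Quotient.mk_eq_zero]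
      have h1 := LinearMap.congr_fun hv' (K.mkQ x)
      simp only [LinearMap.comp_apply, Submodule.mkQ_apply] at h1
      simp only [w, LinearMap.sub_apply, LinearMap.comp_apply, Submodule.Quotient.mk_sub,
        Submodule.mkQ_apply]
      rw [h1, sub_eq_zero]
      rfl
    refine hmax J' ⟨hIJ.trans hJ'.le, (LinearEquiv.ofInjective j hj).symm.toLinearMap ∘ₗ
      w.codRestrict (LinearMap.range j) hw, fun x hx => hj ?_⟩ hJ'.lt
    have h1 : ∀ y, j ((LinearEquiv.ofInjective j hj).symm y) = y := fun y =>
      congrArg Subtype.val ((LinearEquiv.ofInjective j hj).apply_symm_apply y)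
    have h2 : K.mkQ ⟨x, hJ'.le (hIJ hx)⟩ = 0 :=
      (Submodule.Quotient.mk_eq_zero K).2 (hIJ hx : x ∈ J)
    simp only [LinearMap.comp_apply, LinearEquiv.coe_coe]
    rw [h1, ← hg' x hx]
    simp only [w, LinearMap.codRestrict_apply, LinearMap.sub_apply, LinearMap.comp_apply, h2,
      map_zero, sub_zero]
    exact hG ⟨x, hIJ hx⟩

lemma Module.exists_injective_embedding (R : Type u) [Ring R] (M : Type u) [AddCommGroup M]
    [Module R M] : ∃ (E : Type u) (_ : AddCommGroup E) (_ : Module R E) (_ : Module.Injective R E)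
      (j : M →ₗ[R] E), Function.Injective j := by
  let I := (CategoryTheory.EnoughInjectives.presentation (ModuleCat.of R M)).some
  exact ⟨I.J, inferInstance, inferInstance, Module.injective_module_of_injective_object R I.J
    (inj := I.injective), I.f.hom, (ModuleCat.mono_iff_injective _).1 I.mono⟩

end SimpleLift

/-! ### Representations as modules over the group algebra -/

section Representations

open scoped MonoidAlgebra

variable {k G : Type*} [Field k] [Group G]

instance isArtinianRing_monoidAlgebra [Finite G] : IsArtinianRing k[G] :=
  isArtinian_of_tower k (inferInstance : IsArtinian k k[G])

instance isNoetherianRing_monoidAlgebra [Finite G] : IsNoetherianRing k[G] :=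
  isNoetherian_of_tower k (inferInstance : IsNoetherian k k[G])

lemma isIrreducible_ofModule' (S : Type*) [AddCommGroup S] [Module k S] [Module k[G] S]
    [IsScalarTower k k[G] S] [IsSimpleModule k[G] S] :
    (Representation.ofModule' (k := k) (G := G) S).IsIrreducible := by
  rw [Representation.irreducible_iff_isSimpleModule_asModule]
  have h : (Representation.ofModule' (k := k) (G := G) S).asAlgebraHom = Algebra.lsmul k k S :=
    Equiv.apply_symm_apply _ _
  let e : (Representation.ofModule' (k := k) (G := G) S).asModule ≃ₗ[k[G]] S :=
    { (Representation.ofModule' (k := k) (G := G) S).asModuleEquiv.toAddEquiv with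
      map_smul' r x := by
        have := Representation.asModuleEquiv_map_smul
          (Representation.ofModule' (k := k) (G := G) S) r x
        rw [h] at this
        exact this }
  exact IsSimpleModule.congr e

/-- A `k`-linear map that commutes with the action of `G` is linear over the group algebra. -/
def linearMapOfCommutes {V W : Type*} [AddCommGroup V] [Module k V] [Module k[G] V]
    [IsScalarTower k k[G] V] [AddCommGroup W] [Module k W] [Module k[G] W]
    [IsScalarTower k k[G] W] (f : V →ₗ[k] W)
    (hf : ∀ (g : G) v, f (MonoidAlgebra.of k G g • v) = MonoidAlgebra.of k G g • f v) :
    V →ₗ[k[G]] W where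
  __ := f
  map_smul' r v := by
    change f (r • v) = r • f v
    induction r using MonoidAlgebra.induction_on with
    | of g => exact hf g v
    | add x y hx hy => rw [add_smul, map_add, hx, hy, add_smul]
    | smul c x hx => rw [smul_assoc, map_smul, hx, smul_assoc]

/-- The extension property of a representation that is injective over the group algebra. -/
lemma exists_equivariant_extension {k G M X Y : Type u} [Field k] [Group G] [AddCommGroup M]
    [Module k M] [AddCommGroup X] [Module k X] [AddCommGroup Y] [Module k Y]
    {ρ : Representation k G M} (hρ : Module.Injective k[G] ρ.asModule)
    (ρX : Representation k G X) (ρY : Representation k G Y) (i : X →ₗ[k] Y) (f : X →ₗ[k] M)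
    (hinj : Function.Injective i) (hi : ∀ g x, i (ρX g x) = ρY g (i x))
    (hf : ∀ g x, f (ρX g x) = ρ g (f x)) :
    ∃ f' : Y →ₗ[k] M, (∀ g y, f' (ρY g y) = ρ g (f' y)) ∧ f' ∘ₗ i = f := by
  let i' := Representation.IntertwiningMap.equivLinearMapAsModule ρX ρY
    (i.intertwiningMap_of_isIntertwiningMap ρX ρY hi)
  let f' := Representation.IntertwiningMap.equivLinearMapAsModule ρX ρ
    (f.intertwiningMap_of_isIntertwiningMap ρX ρ hf)
  obtain ⟨h, hh⟩ := hρ.out i' hinj f'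
  let h' := (Representation.IntertwiningMap.equivLinearMapAsModule ρY ρ).symm h
  exact ⟨h'.toLinearMap, fun g y => LinearMap.congr_fun (h'.isIntertwining' g) y,
    LinearMap.ext hh⟩

end Representations

/-! ### Frobenius reciprocity -/

section Reciprocity

variable {k A : Type*} [Field k] [CommRing A] [HopfAlgebra k A]

lemma counit_comp_leftTranslate (g : WithConv (A →ₐ[k] k)) :
    Coalgebra.counit ∘ₗ leftTranslate g = g.ofConv.toLinearMap := by
  ext a
  have h : ∀ z : A ⊗[k] A, Coalgebra.counit (R := k)
      (TensorProduct.lid k A (g.ofConv.toLinearMap.rTensor A z)) =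
      g.ofConv (TensorProduct.rid k A (Coalgebra.counit.lTensor A z)) := by
    intro z
    induction z using TensorProduct.induction_on with
    | zero => simp
    | tmul x y => simp [mul_comm]
    | add x y hx hy => simp only [map_add, hx, hy]
  have h1 := h (Coalgebra.comul a)
  rw [Coalgebra.lTensor_counit_comul, TensorProduct.rid_tmul, one_smul] at h1
  exact h1

namespace Coaction

variable {X Y : Type*} [AddCommGroup X] [Module k X] [AddCommGroup Y] [Module k Y]

lemma pointAction_apply (σ : Coaction k A X) (g : WithConv (A →ₐ[k] k)) (x : X) :
    σ.pointAction g x = slice X g.ofConv.toLinearMap (σ.coact x) := rfl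

/-- The representation of the group of rational points on a module over the group scheme. -/
def pointRep (σ : Coaction k A X) : Representation k (WithConv (A →ₐ[k] k)) X where
  toFun := σ.pointAction
  map_one' := by
    have h : (1 : WithConv (A →ₐ[k] k)).ofConv.toLinearMap = Coalgebra.counit := by
      ext a; exact AlgHom.convOne_apply (R := k) (A := k) a
    ext x
    rw [pointAction_apply, h]
    exact σ.rid_lTensor_counit_coact x
  map_mul' g g' := by
    ext x
    have h : ∀ c : A, (g * g').ofConv c =
        g.ofConv (slice A g'.ofConv.toLinearMap (Coalgebra.comul c)) := by
      intro c
      refine (AlgHom.convMul_apply g g' c).trans ?_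
      generalize Coalgebra.comul (R := k) c = z
      induction z using TensorProduct.induction_on with
      | zero => simp
      | tmul x y => simp [mul_comm]
      | add x y hx hy => simp only [map_add, hx, hy]
    rw [Module.End.mul_apply, pointAction_apply, pointAction_apply, pointAction_apply,
      σ.coact_slice]
    generalize σ.coact x = w
    induction w using TensorProduct.induction_on with
    | zero => simp
    | tmul x c => simp [h]
    | add x y hx hy => simp only [map_add, hx, hy]

lemma IsHom.map_pointAction {σ : Coaction k A X} {τ : Coaction k A Y} {f : X →ₗ[k] Y}
    (hf : σ.IsHom τ f) (g : WithConv (A →ₐ[k] k)) (x : X) :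
    f (σ.pointAction g x) = τ.pointAction g (f x) := by
  have h1 : ∀ w : X ⊗[k] A, f (slice X g.ofConv.toLinearMap w) =
      slice Y g.ofConv.toLinearMap (f.rTensor A w) := by
    intro w
    induction w using TensorProduct.induction_on with
    | zero => simp
    | tmul x c => simp
    | add x y hx hy => simp only [map_add, hx, hy]
  rw [pointAction_apply, pointAction_apply, h1]
  exact congrArg _ (LinearMap.congr_fun hf x).symm

lemma IsHom.comp {Z : Type*} [AddCommGroup Z] [Module k Z] {σ : Coaction k A X}
    {τ : Coaction k A Y} {υ : Coaction k A Z} {g : Y →ₗ[k] Z} {f : X →ₗ[k] Y}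
    (hg : τ.IsHom υ g) (hf : σ.IsHom τ f) : σ.IsHom υ (g ∘ₗ f) := by
  rw [IsHom] at *
  rw [← LinearMap.comp_assoc, hg, LinearMap.comp_assoc, hf, ← LinearMap.comp_assoc,
    LinearMap.rTensor_comp]

end Coaction

variable {Γ M N X : Type*} [Group Γ] [AddCommGroup M] [Module k M] [AddCommGroup N] [Module k N]
  [AddCommGroup X] [Module k X]

/-- Evaluation of the functions in an induced module at the unit element. -/
def indEval (ι : Γ →* WithConv (A →ₐ[k] k)) (ρ : Representation k Γ M) :
    indSubmodule ι ρ →ₗ[k] M :=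
  slice M Coalgebra.counit ∘ₗ (indSubmodule ι ρ).subtype

variable {ι : Γ →* WithConv (A →ₐ[k] k)} {ρ : Representation k Γ M} {ρN : Representation k Γ N}

lemma mem_indSubmodule {x : M ⊗[k] A} : x ∈ indSubmodule ι ρ ↔
    ∀ g, (ρ g).rTensor A x = (leftTranslate (ι g)).lTensor M x := by
  simp only [indSubmodule, Submodule.mem_iInf, LinearMap.mem_eqLocus]

/-- Evaluation at the unit element is equivariant, as `f(h) = h · f(1)`. -/
lemma indEval_pointAction (g : Γ) (x : indSubmodule ι ρ) :
    indEval ι ρ ((ind ι ρ).pointAction (ι g) x) = ρ g (indEval ι ρ x) := by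
  have h1 : ((ind ι ρ).pointAction (ι g) x : M ⊗[k] A) =
      slice (M ⊗[k] A) (ι g).ofConv.toLinearMap (rightRegular k A M x) := by
    have h2 := LinearMap.congr_fun (rTensor_subtype_indCoact ι ρ) x
    simp only [LinearMap.comp_apply, Submodule.subtype_apply] at h2
    rw [← h2, Coaction.pointAction_apply]
    change (indSubmodule ι ρ).subtype (slice _ _ (indCoact ι ρ x)) = _
    generalize indCoact ι ρ x = w
    induction w using TensorProduct.induction_on with
    | zero => simp
    | tmul x c => simp
    | add x y hx hy => simp only [map_add, hx, hy]
  have h3 : ∀ y : M ⊗[k] A, slice M Coalgebra.counit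
      (slice (M ⊗[k] A) (ι g).ofConv.toLinearMap (rightRegular k A M y)) =
      slice M (ι g).ofConv.toLinearMap y := by
    intro y
    induction y using TensorProduct.induction_on with
    | zero => simp
    | tmul m a =>
      have h4 : ∀ z : A ⊗[k] A, slice M Coalgebra.counit (slice (M ⊗[k] A)
          (ι g).ofConv.toLinearMap ((TensorProduct.assoc k M A A).symm (m ⊗ₜ z))) =
          (ι g).ofConv (TensorProduct.lid k A (Coalgebra.counit.rTensor A z)) • m := by
        intro z
        induction z using TensorProduct.induction_on with
        | zero => simp
        | tmul x y => simp [smul_smul, mul_comm]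
        | add x y hx hy => simp only [map_add, TensorProduct.tmul_add, hx, hy, add_smul]
      have h5 := h4 (Coalgebra.comul a)
      rw [Coalgebra.rTensor_counit_comul, TensorProduct.lid_tmul, one_smul] at h5
      simpa [rightRegular] using h5
    | add x y hx hy => simp only [map_add, hx, hy]
  have h6 : ∀ y : M ⊗[k] A, slice M (ι g).ofConv.toLinearMap y =
      slice M Coalgebra.counit ((leftTranslate (ι g)).lTensor M y) := by
    intro y
    rw [← counit_comp_leftTranslate, slice, slice, LinearMap.lTensor_comp]
    rfl
  have h7 : ∀ y : M ⊗[k] A, slice M Coalgebra.counit ((ρ g).rTensor A y) =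
      ρ g (slice M Coalgebra.counit y) := by
    intro y
    induction y using TensorProduct.induction_on with
    | zero => simp
    | tmul m a => simp
    | add x y hx hy => simp only [map_add, hx, hy]
  change slice M Coalgebra.counit ((ind ι ρ).pointAction (ι g) x : M ⊗[k] A) =
    ρ g (slice M Coalgebra.counit (x : M ⊗[k] A))
  rw [h1, h3, h6, ← mem_indSubmodule.1 x.2 g, h7]

/-- A homomorphism to an induced module is determined by its composite with the evaluation. -/
lemma Coaction.IsHom.rTensor_indEval_coact {σ : Coaction k A X} {f : X →ₗ[k] indSubmodule ι ρ}
    (hf : σ.IsHom (ind ι ρ) f) (x : X) :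
    (indEval ι ρ ∘ₗ f).rTensor A (σ.coact x) = (f x : M ⊗[k] A) := by
  have h1 := LinearMap.congr_fun hf x
  have h2 := LinearMap.congr_fun (rTensor_subtype_indCoact ι ρ) (f x)
  simp only [LinearMap.comp_apply, Submodule.subtype_apply] at h1 h2
  rw [LinearMap.rTensor_comp_apply, ← h1, indEval, LinearMap.rTensor_comp_apply]
  change (slice M Coalgebra.counit).rTensor A ((indSubmodule ι ρ).subtype.rTensor A
    (indCoact ι ρ (f x))) = _
  rw [h2]
  generalize (f x : M ⊗[k] A) = y
  induction y using TensorProduct.induction_on with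
  | zero => simp
  | tmul m a =>
    have h4 : ∀ z : A ⊗[k] A, (slice M Coalgebra.counit).rTensor A
        ((TensorProduct.assoc k M A A).symm (m ⊗ₜ z)) =
        m ⊗ₜ (TensorProduct.lid k A (Coalgebra.counit.rTensor A z)) := by
      intro z
      induction z using TensorProduct.induction_on with
      | zero => simp
      | tmul x y => simp [TensorProduct.smul_tmul]
      | add x y hx hy => simp only [map_add, TensorProduct.tmul_add, hx, hy]
    have h5 := h4 (Coalgebra.comul a)
    rw [Coalgebra.rTensor_counit_comul, TensorProduct.lid_tmul, one_smul] at h5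
    simpa [rightRegular] using h5
  | add x y hx hy => simp only [map_add, hx, hy]

/-- The function `y ↦ f(y x)` attached to an equivariant map `f` and an element `x` of a module over
the group scheme lies in the induced module. -/
lemma rTensor_coact_mem_indSubmodule (σ : Coaction k A X) (f : X →ₗ[k] M)
    (hf : ∀ g x, f (σ.pointAction (ι g) x) = ρ g (f x)) (x : X) :
    f.rTensor A (σ.coact x) ∈ indSubmodule ι ρ := by
  rw [mem_indSubmodule]
  intro g
  have h1 : (σ.pointAction (ι g)).rTensor A (σ.coact x) =
      (leftTranslate (ι g)).lTensor X (σ.coact x) := by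
    have h2 : ∀ w : X ⊗[k] A, (σ.pointAction (ι g)).rTensor A w =
        (slice X (ι g).ofConv.toLinearMap).rTensor A (σ.coact.rTensor A w) := by
      intro w
      rw [← LinearMap.rTensor_comp_apply]
      rfl
    rw [h2, σ.rTensor_coact_coact]
    generalize σ.coact x = w
    induction w using TensorProduct.induction_on with
    | zero => simp
    | tmul v c =>
      simp only [LinearMap.lTensor_tmul, leftTranslate, LinearMap.comp_apply, LinearEquiv.coe_coe]
      generalize Coalgebra.comul (R := k) c = z
      induction z using TensorProduct.induction_on with
      | zero => simp
      | tmul x y => simp [TensorProduct.smul_tmul]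
      | add x y hx hy => simp only [map_add, TensorProduct.tmul_add, hx, hy]
    | add x y hx hy => simp only [map_add, hx, hy]
  have h3 : ρ g ∘ₗ f = f ∘ₗ σ.pointAction (ι g) := by
    ext x; exact (hf g x).symm
  rw [← LinearMap.rTensor_comp_apply, h3, LinearMap.rTensor_comp_apply, h1]
  exact LinearMap.congr_fun
    ((LinearMap.rTensor_comp_lTensor ..).trans (LinearMap.lTensor_comp_rTensor ..).symm) _

/-- The homomorphism to an induced module that corresponds to an equivariant map under Frobenius
reciprocity. -/
def indLift (σ : Coaction k A X) (f : X →ₗ[k] M)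
    (hf : ∀ g x, f (σ.pointAction (ι g) x) = ρ g (f x)) : X →ₗ[k] indSubmodule ι ρ :=
  (f.rTensor A ∘ₗ σ.coact).codRestrict _ (rTensor_coact_mem_indSubmodule σ f hf)

/-- Homomorphisms to the induced module can be tested in the space of all regular functions. -/
lemma isHom_ind_iff {σ : Coaction k A X} {f : X →ₗ[k] indSubmodule ι ρ} :
    σ.IsHom (ind ι ρ) f ↔ ∀ x, rightRegular k A M (f x) =
      ((indSubmodule ι ρ).subtype ∘ₗ f).rTensor A (σ.coact x) := by
  have h1 : ∀ x, (indSubmodule ι ρ).subtype.rTensor A ((ind ι ρ).coact (f x)) =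
      rightRegular k A M (f x) := fun x => LinearMap.congr_fun (rTensor_subtype_indCoact ι ρ) (f x)
  have hinj := Module.Flat.rTensor_preserves_injective_linearMap (M := A)
    (indSubmodule ι ρ).subtype (Submodule.subtype_injective _)
  constructor
  · intro h x
    rw [← h1, LinearMap.rTensor_comp_apply]
    exact congrArg _ (LinearMap.congr_fun h x)
  · intro h
    ext x : 1
    apply hinj
    rw [LinearMap.comp_apply, h1, h, LinearMap.rTensor_comp_apply]
    rfl

lemma isHom_indLift (σ : Coaction k A X) (f : X →ₗ[k] M)
    (hf : ∀ g x, f (σ.pointAction (ι g) x) = ρ g (f x)) :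
    σ.IsHom (ind ι ρ) (indLift σ f hf) := by
  rw [isHom_ind_iff]
  intro x
  have h1 : (indSubmodule ι ρ).subtype ∘ₗ indLift σ f hf = f.rTensor A ∘ₗ σ.coact := rfl
  rw [h1, LinearMap.rTensor_comp_apply, σ.rTensor_coact_coact]
  change rightRegular k A M (f.rTensor A (σ.coact x)) = _
  generalize σ.coact x = w
  induction w using TensorProduct.induction_on with
  | zero => simp
  | tmul v c =>
    simp only [rightRegular, LinearMap.comp_apply, LinearEquiv.coe_coe, LinearMap.rTensor_tmul,
      LinearMap.lTensor_tmul]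
    generalize Coalgebra.comul (R := k) c = z
    induction z using TensorProduct.induction_on with
    | zero => simp
    | tmul x y => simp
    | add x y hx hy => simp only [map_add, TensorProduct.tmul_add, hx, hy]
  | add x y hx hy => simp only [map_add, hx, hy]

lemma indEval_indLift (σ : Coaction k A X) (f : X →ₗ[k] M)
    (hf : ∀ g x, f (σ.pointAction (ι g) x) = ρ g (f x)) (x : X) :
    indEval ι ρ (indLift σ f hf x) = f x := by
  change slice M Coalgebra.counit (f.rTensor A (σ.coact x)) = f x
  conv_rhs => rw [← σ.rid_lTensor_counit_coact x]
  generalize σ.coact x = w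
  induction w using TensorProduct.induction_on with
  | zero => simp
  | tmul v c => simp
  | add x y hx hy => simp only [map_add, hx, hy]

/-- Induction is right adjoint to the exact restriction functor, so it preserves injectivity. -/
theorem ind_isInjective {k A M Γ : Type u} [Field k] [CommRing A] [HopfAlgebra k A] [Group Γ]
    [AddCommGroup M] [Module k M] (ι : Γ →* WithConv (A →ₐ[k] k)) (ρ : Representation k Γ M)
    (hρ : Module.Injective (MonoidAlgebra k Γ) ρ.asModule) : (ind ι ρ).IsInjective := by
  intro X Y _ _ _ _ σX σY i f hi hinj hf
  obtain ⟨f', hf', hfi⟩ := exists_equivariant_extension hρ (σX.pointRep.comp ι)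
    (σY.pointRep.comp ι) i (indEval ι ρ ∘ₗ f) hinj (fun g x => hi.map_pointAction (ι g) x)
    (fun g x => by
      refine Eq.trans ?_ (indEval_pointAction g (f x))
      exact congrArg (indEval ι ρ) (hf.map_pointAction (ι g) x))
  refine ⟨indLift σY f' hf', isHom_indLift σY f' hf', ?_⟩
  ext1 x
  apply Subtype.ext
  have h1 := LinearMap.congr_fun hi x
  simp only [LinearMap.comp_apply] at h1
  change f'.rTensor A (σY.coact (i x)) = _
  rw [h1, ← LinearMap.rTensor_comp_apply, hfi]
  exact hf.rTensor_indEval_coact x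

/-- The homomorphism of induced modules attached to an equivariant map. -/
def indMap (ι : Γ →* WithConv (A →ₐ[k] k)) (f : M →ₗ[k] N) (hf : ∀ g x, f (ρ g x) = ρN g (f x)) :
    indSubmodule ι ρ →ₗ[k] indSubmodule ι ρN :=
  (f.rTensor A).restrict (by
    intro x hx
    rw [mem_indSubmodule] at hx ⊢
    intro g
    have h1 : ρN g ∘ₗ f = f ∘ₗ ρ g := by ext x; exact (hf g x).symm
    rw [← LinearMap.rTensor_comp_apply, h1, LinearMap.rTensor_comp_apply, hx,
      ← LinearMap.comp_apply, ← LinearMap.comp_apply, LinearMap.rTensor_comp_lTensor,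
      LinearMap.lTensor_comp_rTensor])

lemma coe_indMap (f : M →ₗ[k] N) (hf : ∀ g x, f (ρ g x) = ρN g (f x)) (x : indSubmodule ι ρ) :
    (indMap ι f hf x : N ⊗[k] A) = f.rTensor A x := rfl

lemma isHom_indMap (f : M →ₗ[k] N) (hf : ∀ g x, f (ρ g x) = ρN g (f x)) :
    (ind ι ρ).IsHom (ind ι ρN) (indMap ι f hf) := by
  rw [isHom_ind_iff]
  intro x
  have h1 : (indSubmodule ι ρN).subtype ∘ₗ indMap ι f hf =
      f.rTensor A ∘ₗ (indSubmodule ι ρ).subtype := rfl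
  have h2 := LinearMap.congr_fun (rTensor_subtype_indCoact ι ρ) x
  simp only [LinearMap.comp_apply, Submodule.subtype_apply] at h2
  rw [h1, LinearMap.rTensor_comp_apply]
  change _ = (f.rTensor A).rTensor A ((indSubmodule ι ρ).subtype.rTensor A (indCoact ι ρ x))
  rw [h2, coe_indMap]
  generalize (x : M ⊗[k] A) = w
  induction w using TensorProduct.induction_on with
  | zero => simp
  | tmul v c =>
    simp only [rightRegular, LinearMap.comp_apply, LinearEquiv.coe_coe, LinearMap.rTensor_tmul,
      LinearMap.lTensor_tmul]
    generalize Coalgebra.comul (R := k) c = z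
    induction z using TensorProduct.induction_on with
    | zero => simp
    | tmul x y => simp
    | add x y hx hy => simp only [map_add, TensorProduct.tmul_add, hx, hy]
  | add x y hx hy => simp only [map_add, hx, hy]

lemma indEval_indMap (f : M →ₗ[k] N) (hf : ∀ g x, f (ρ g x) = ρN g (f x)) (x : indSubmodule ι ρ) :
    indEval ι ρN (indMap ι f hf x) = f (indEval ι ρ x) := by
  change slice N Coalgebra.counit (f.rTensor A (x : M ⊗[k] A)) =
    f (slice M Coalgebra.counit (x : M ⊗[k] A))
  generalize (x : M ⊗[k] A) = w
  induction w using TensorProduct.induction_on with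
  | zero => simp
  | tmul v c => simp
  | add x y hx hy => simp only [map_add, hx, hy]

end Reciprocity

/-! ### Exactness of induction from a finite group -/

section Exactness

open WithConv

variable {k A : Type*} [Field k] [CommRing A] [HopfAlgebra k A]

lemma leftTranslate_one_apply (a : A) : leftTranslate (1 : WithConv (A →ₐ[k] k)) a = a := by
  have h : toConv ((Algebra.ofId k A).comp (1 : WithConv (A →ₐ[k] k)).ofConv) =
      (1 : WithConv (A →ₐ[k] A)) := rfl
  rw [leftTranslate_eq_convMul, h, one_mul]
  rfl

lemma leftTranslate_mul_apply (g h : WithConv (A →ₐ[k] k)) (a : A) :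
    leftTranslate (g * h) a = leftTranslate h (leftTranslate g a) := by
  have h1 : ∀ g : WithConv (A →ₐ[k] k), (toConv ((Algebra.ofId k A).comp h.ofConv) *
      toConv (AlgHom.id k A) : WithConv (A →ₐ[k] A)).ofConv.comp
        ((Algebra.ofId k A).comp g.ofConv) = (Algebra.ofId k A).comp g.ofConv := by
    intro g
    rw [← AlgHom.comp_assoc]
    congr 1
    ext
  have h2 := AlgHom.comp_convMul_distrib (toConv ((Algebra.ofId k A).comp h.ofConv) *
    toConv (AlgHom.id k A) : WithConv (A →ₐ[k] A)).ofConv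
    (toConv ((Algebra.ofId k A).comp g.ofConv)) (toConv (AlgHom.id k A))
  rw [ofConv_toConv, ofConv_toConv, h1, AlgHom.comp_id, toConv_ofConv, ← mul_assoc] at h2
  rw [leftTranslate_eq_convMul, leftTranslate_eq_convMul, leftTranslate_eq_convMul,
    AlgHom.comp_convMul_distrib, toConv_ofConv]
  exact (AlgHom.congr_fun h2 a).symm

variable {Γ : Type*} [Group Γ]

/-- The action of a group of rational points on the functions on `G`,
`(g · f) (x) = f (g⁻¹ x)`. -/
@[reducible]
def translationAction (ι : Γ →* WithConv (A →ₐ[k] k)) : MulSemiringAction Γ A where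
  smul g a := leftTranslate (ι g⁻¹) a
  one_smul a := by
    change leftTranslate (ι 1⁻¹) a = a
    rw [inv_one, map_one, leftTranslate_one_apply]
  mul_smul g h a := by
    change leftTranslate (ι (g * h)⁻¹) a = leftTranslate (ι g⁻¹) (leftTranslate (ι h⁻¹) a)
    rw [mul_inv_rev, map_mul, leftTranslate_mul_apply]
  smul_zero g := map_zero _
  smul_add g := map_add _
  smul_one g := by
    change leftTranslate (ι g⁻¹) (1 : A) = 1
    simp [leftTranslate_eq_convMul]
  smul_mul g := leftTranslate_mul _

/-- The functions that are invariant under left translation by a group of rational points. -/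
def translationInvariants (ι : Γ →* WithConv (A →ₐ[k] k)) : Subalgebra k A where
  carrier := {a | ∀ g, leftTranslate (ι g) a = a}
  mul_mem' ha hb g := by rw [leftTranslate_mul, ha, hb]
  add_mem' ha hb g := by rw [map_add, ha, hb]
  algebraMap_mem' c g := by simp [leftTranslate_eq_convMul]

/-- A finite group of rational points acts freely on `G` by translations, so some function has
trace `1` over the invariant functions. -/
theorem exists_sum_leftTranslate_eq_one [Fintype Γ] (ι : Γ →* WithConv (A →ₐ[k] k))
    (hι : Function.Injective ι) : ∃ a : A, ∑ g, leftTranslate (ι g) a = 1 := by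
  let T : A →ₗ[k] A := ∑ g, leftTranslate (ι g)
  have hmem : ∀ a, T a ∈ translationInvariants ι := by
    intro a g
    simp only [T, LinearMap.sum_apply, map_sum]
    refine Fintype.sum_equiv (Equiv.mulRight g) _ _ fun h => ?_
    rw [Equiv.coe_mulRight, map_mul, leftTranslate_mul_apply]
  let _ := translationAction ι
  have : Algebra.IsInvariant (translationInvariants ι) A Γ := by
    refine ⟨fun b hb => ⟨⟨b, fun g => ?_⟩, rfl⟩⟩
    have h1 : leftTranslate (ι g⁻¹⁻¹) b = b := hb g⁻¹
    rwa [inv_inv] at h1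
  have := Algebra.IsInvariant.isIntegral (translationInvariants ι) A Γ
  let T' : A →ₗ[translationInvariants ι] translationInvariants ι :=
    { toFun a := ⟨T a, hmem a⟩
      map_add' x y := Subtype.ext (map_add T x y)
      map_smul' b a := by
        ext
        have hb : ∀ g, leftTranslate (ι g) (b : A) = b := b.2
        simp [T, Algebra.smul_def, leftTranslate_mul, hb, Finset.mul_sum] }
  have hcomul : Coalgebra.comul ∘ₗ T = T.rTensor A ∘ₗ Coalgebra.comul := by
    have h1 : T.rTensor A = ∑ g, (leftTranslate (ι g)).rTensor A :=
      map_sum (LinearMap.rTensorHom (R := k) A) (fun g => leftTranslate (ι g)) _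
    ext a
    simp only [h1, T, LinearMap.comp_apply, LinearMap.sum_apply, map_sum]
    exact Finset.sum_congr rfl fun g _ => LinearMap.congr_fun (comul_comp_leftTranslate (ι g)) a
  have hcounit : ∀ a, Coalgebra.counit (R := k) (T a) = ∑ g, (ι g).ofConv a := by
    intro a
    simp only [T, LinearMap.sum_apply, map_sum]
    exact Finset.sum_congr rfl fun g _ => LinearMap.congr_fun (counit_comp_leftTranslate (ι g)) a
  -- distinct points are linearly independent as characters, so their sum does not vanish
  obtain ⟨a, ha⟩ : ∃ a : A, ∑ g, (ι g).ofConv a ≠ 0 := by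
    by_contra! h
    let χ : Γ → (A →* k) := fun g => ((ι g).ofConv : A →* k)
    have hχ : Function.Injective χ := by
      intro g g' h
      apply hι
      apply ofConv_injective
      ext x
      exact DFunLike.congr_fun h x
    have hli := (linearIndependent_monoidHom A k).comp χ hχ
    rw [Fintype.linearIndependent_iff] at hli
    refine one_ne_zero (hli (fun _ => (1 : k)) ?_ 1)
    ext a
    simpa [χ] using h a
  obtain ⟨a', ha'⟩ := exists_apply_eq_one_of_span_range_eq_top (translationInvariants ι) T'
    (span_range_eq_top_of_comul_comp_eq_rTensor T hcomul ((∑ g, (ι g).ofConv a)⁻¹ • a)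
      (by rw [map_smul, map_smul, hcounit, smul_eq_mul, inv_mul_cancel₀ ha]))
  refine ⟨a', ?_⟩
  have h1 : T a' = 1 := congrArg Subtype.val ha'
  simpa [T] using h1

variable {M N P : Type*} [AddCommGroup M] [Module k M] [AddCommGroup N] [Module k N]
  [AddCommGroup P] [Module k P] {ι : Γ →* WithConv (A →ₐ[k] k)}
  {ρ : Representation k Γ M} {ρN : Representation k Γ N} {ρP : Representation k Γ P}

/-- Induction from a finite group of rational points preserves surjectivity: a lift `x` of an
element of the induced module is made invariant by averaging `a x` over the group, where `a` has
trace `1`. -/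
lemma indMap_surjective [Finite Γ] (hι : Function.Injective ι) (f : M →ₗ[k] N)
    (hf : ∀ g x, f (ρ g x) = ρN g (f x)) (hsurj : Function.Surjective f) :
    Function.Surjective (indMap ι f hf) := by
  have := Fintype.ofFinite Γ
  intro y
  obtain ⟨a, ha⟩ := exists_sum_leftTranslate_eq_one ι hι
  obtain ⟨x, hx⟩ := LinearMap.rTensor_surjective A hsurj (y : N ⊗[k] A)
  let E : M ⊗[k] A →ₗ[k] M ⊗[k] A := ∑ g : Γ,
    TensorProduct.map (ρ g) (leftTranslate (ι g⁻¹)) ∘ₗ (LinearMap.mulLeft k a).lTensor M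
  refine ⟨⟨E x, mem_indSubmodule.2 fun h => ?_⟩, Subtype.ext ?_⟩
  · simp only [E, LinearMap.sum_apply, map_sum]
    refine Fintype.sum_equiv (Equiv.mulLeft h) _ _ fun g => ?_
    simp only [LinearMap.comp_apply, Equiv.coe_mulLeft]
    generalize (LinearMap.mulLeft k a).lTensor M x = w
    induction w using TensorProduct.induction_on with
    | zero => simp
    | tmul m b =>
      simp only [TensorProduct.map_tmul, LinearMap.rTensor_tmul, LinearMap.lTensor_tmul]
      rw [← leftTranslate_mul_apply, ← map_mul ι, mul_inv_rev, inv_mul_cancel_right, map_mul ρ,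
        Module.End.mul_apply]
    | add x y hx hy => simp only [map_add, hx, hy]
  · rw [coe_indMap]
    have hy := mem_indSubmodule.1 y.2
    have h1 : ∀ g, f.rTensor A (TensorProduct.map (ρ g) (leftTranslate (ι g⁻¹))
        ((LinearMap.mulLeft k a).lTensor M x)) =
        (LinearMap.mulLeft k (leftTranslate (ι g⁻¹) a)).lTensor N y := by
      intro g
      have h2 : ∀ w : M ⊗[k] A, f.rTensor A (TensorProduct.map (ρ g) (leftTranslate (ι g⁻¹))
          ((LinearMap.mulLeft k a).lTensor M w)) =
          (LinearMap.mulLeft k (leftTranslate (ι g⁻¹) a)).lTensor N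
            ((leftTranslate (ι g⁻¹)).lTensor N ((ρN g).rTensor A (f.rTensor A w))) := by
        intro w
        induction w using TensorProduct.induction_on with
        | zero => simp
        | tmul m b => simp [hf, leftTranslate_mul]
        | add x y hx hy => simp only [map_add, hx, hy]
      have h3 : leftTranslate (ι g⁻¹) ∘ₗ leftTranslate (ι g) = LinearMap.id (R := k) (M := A) := by
        ext b
        simp [← leftTranslate_mul_apply, leftTranslate_one_apply]
      rw [h2, hx, hy, ← LinearMap.comp_apply (LinearMap.lTensor N (leftTranslate (ι g⁻¹))),
        ← LinearMap.lTensor_comp, h3, LinearMap.lTensor_id, LinearMap.id_apply]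
    simp only [E, LinearMap.sum_apply, LinearMap.comp_apply, map_sum, h1]
    have h2 : ∀ w : N ⊗[k] A, ∑ g : Γ, (LinearMap.mulLeft k (leftTranslate (ι g⁻¹) a)).lTensor N w
        = w := by
      intro w
      induction w using TensorProduct.induction_on with
      | zero => simp
      | tmul n b =>
        have h3 : ∑ g : Γ, leftTranslate (ι g⁻¹) a = 1 :=
          (Fintype.sum_equiv (Equiv.inv Γ) _ _ fun g => by simp).trans ha
        simp only [LinearMap.lTensor_tmul, LinearMap.mulLeft_apply]
        rw [← TensorProduct.tmul_sum, ← Finset.sum_mul, h3, one_mul]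
      | add x y hx hy => simp only [map_add, Finset.sum_add_distrib, hx, hy]
    exact h2 y

/-- Induction is left exact. -/
lemma exists_indMap_eq_of_indMap_eq_zero (j : M →ₗ[k] N) (f : N →ₗ[k] P)
    (hj : ∀ g x, j (ρ g x) = ρN g (j x)) (hf : ∀ g x, f (ρN g x) = ρP g (f x))
    (hinj : Function.Injective j) (hex : Function.Exact j f) (x : indSubmodule ι ρN)
    (hx : indMap ι f hf x = 0) : ∃ y, indMap ι j hj y = x := by
  have h1 : f.rTensor A (x : N ⊗[k] A) = 0 := congrArg Subtype.val hx
  obtain ⟨y, hy⟩ := (Module.Flat.rTensor_exact A hex _).1 h1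
  refine ⟨⟨y, mem_indSubmodule.2 fun g => ?_⟩, Subtype.ext hy⟩
  apply Module.Flat.rTensor_preserves_injective_linearMap (M := A) j hinj
  have h2 : j ∘ₗ ρ g = ρN g ∘ₗ j := by ext x; exact hj g x
  rw [← LinearMap.rTensor_comp_apply, h2, LinearMap.rTensor_comp_apply, hy,
    mem_indSubmodule.1 x.2 g, ← hy]
  exact LinearMap.congr_fun
    ((LinearMap.lTensor_comp_rTensor ..).trans (LinearMap.rTensor_comp_lTensor ..).symm) y

/-- Let `0 → M → N → P → 0` be an exact sequence of representations of a finite group of rational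
points.  If `ind M` is injective, the exact sequence of induced modules splits, so a homomorphism
to `P` from the restriction of a `G`-module `S` lifts to `N`, by Frobenius reciprocity. -/
theorem exists_equivariant_lift {k A M N P S : Type u} {Γ : Type*} [Group Γ] [Finite Γ] [Field k]
    [CommRing A] [HopfAlgebra k A] [AddCommGroup M] [Module k M] [AddCommGroup N] [Module k N]
    [AddCommGroup P] [Module k P] [AddCommGroup S] [Module k S] {ι : Γ →* WithConv (A →ₐ[k] k)}
    (hι : Function.Injective ι)
    {ρ : Representation k Γ M} {ρN : Representation k Γ N} {ρP : Representation k Γ P}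
    (hM : (ind ι ρ).IsInjective) (j : M →ₗ[k] N) (f : N →ₗ[k] P)
    (hj : ∀ g x, j (ρ g x) = ρN g (j x)) (hf : ∀ g x, f (ρN g x) = ρP g (f x))
    (hinj : Function.Injective j) (hsurj : Function.Surjective f) (hex : Function.Exact j f)
    (σ : Coaction k A S) (v : S →ₗ[k] P) (hv : ∀ g x, v (σ.pointAction (ι g) x) = ρP g (v x)) :
    ∃ v' : S →ₗ[k] N, (∀ g x, v' (σ.pointAction (ι g) x) = ρN g (v' x)) ∧ f ∘ₗ v' = v := by
  have hiinj : Function.Injective (indMap ι j hj) := by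
    intro x y h
    exact Subtype.ext (Module.Flat.rTensor_preserves_injective_linearMap (M := A) j hinj
      (congrArg Subtype.val h))
  obtain ⟨r, hr, hrj⟩ := hM _ _ (ind ι ρ) (ind ι ρN) (indMap ι j hj) LinearMap.id
    (isHom_indMap j hj) hiinj (by simp [Coaction.IsHom])
  -- `e` is the projection of `ind N` along `ind M`; it induces a section of `ind N → ind P`
  let e : indSubmodule ι ρN →ₗ[k] indSubmodule ι ρN := LinearMap.id - indMap ι j hj ∘ₗ r
  have he : (ind ι ρN).IsHom (ind ι ρN) e := by
    have h1 := (isHom_indMap (ι := ι) j hj).comp hr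
    ext1 x
    have h2 := LinearMap.congr_fun h1 x
    simp only [LinearMap.comp_apply] at h2
    simp only [e, LinearMap.comp_apply, LinearMap.sub_apply, LinearMap.id_apply, map_sub, h2,
      LinearMap.rTensor_sub, LinearMap.rTensor_id]
    rfl
  have hfj : ∀ x, indMap ι f hf (indMap ι j hj x) = 0 := by
    intro x
    apply Subtype.ext
    rw [coe_indMap, coe_indMap, ← LinearMap.rTensor_comp_apply,
      hex.linearMap_comp_eq_zero, LinearMap.rTensor_zero]
    rfl
  have hker : LinearMap.ker (indMap ι f hf) ≤ LinearMap.ker e := by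
    intro x hx
    obtain ⟨y, rfl⟩ := exists_indMap_eq_of_indMap_eq_zero j f hj hf hinj hex x hx
    have h1 := LinearMap.congr_fun hrj y
    simp only [LinearMap.comp_apply, LinearMap.id_apply] at h1
    simp [e, h1]
  have hfs := indMap_surjective hι f hf hsurj
  obtain ⟨t, ht⟩ :=
    (indMap ι f hf).exists_rightInverse_of_surjective (LinearMap.range_eq_top.2 hfs)
  let l : indSubmodule ι ρP →ₗ[k] indSubmodule ι ρN := e ∘ₗ t
  have hl : l ∘ₗ indMap ι f hf = e := by
    ext1 x
    rw [← sub_eq_zero]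
    have h1 : t (indMap ι f hf x) - x ∈ LinearMap.ker (indMap ι f hf) := by
      have := LinearMap.congr_fun ht (indMap ι f hf x)
      simp only [LinearMap.comp_apply, LinearMap.id_apply] at this
      rw [LinearMap.mem_ker, map_sub, this, sub_self]
    have h2 : e (t (indMap ι f hf x) - x) = 0 := hker h1
    rwa [map_sub] at h2
  have hlhom : (ind ι ρP).IsHom (ind ι ρN) l := by
    rw [Coaction.IsHom, ← LinearMap.cancel_right hfs, LinearMap.comp_assoc, hl,
      LinearMap.comp_assoc, isHom_indMap (ι := ι) f hf, he, ← hl, LinearMap.rTensor_comp,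
      LinearMap.comp_assoc]
  have hfl : ∀ y, indMap ι f hf (l y) = y := by
    intro y
    have := LinearMap.congr_fun ht y
    simp only [LinearMap.comp_apply, LinearMap.id_apply] at this
    simp [l, e, hfj, this]
  have hlift := hlhom.comp (isHom_indLift σ v hv)
  refine ⟨indEval ι ρN ∘ₗ l ∘ₗ indLift σ v hv, fun g x => ?_, ?_⟩
  · simp only [LinearMap.comp_apply]
    rw [← indEval_pointAction]
    exact congrArg (indEval ι ρN) (hlift.map_pointAction (ι g) x)
  · ext x
    simp only [LinearMap.comp_apply]
    rw [← indEval_indMap f hf, hfl, indEval_indLift]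

end Exactness

/-! ### Descent of injectivity from the induced module -/

section InjectiveOfInd

variable {k A M Γ : Type u} [Group Γ] [Finite Γ] [Field k] [CommRing A] [HopfAlgebra k A]
  [AddCommGroup M] [Module k M] {ι : Γ →* WithConv (A →ₐ[k] k)}

/-- A homomorphism of modules over the group algebra from the restriction of a module over the group
scheme lifts along a surjection whose kernel has injective induced module. -/
lemma exists_linear_lift_of_ind_isInjective (hι : Function.Injective ι)
    (ρ : Representation k Γ M) (hM : (ind ι ρ).IsInjective)
    {E Q S : Type u} [AddCommGroup E] [Module k E] [Module (MonoidAlgebra k Γ) E]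
    [IsScalarTower k (MonoidAlgebra k Γ) E] [AddCommGroup Q] [Module k Q]
    [Module (MonoidAlgebra k Γ) Q] [IsScalarTower k (MonoidAlgebra k Γ) Q]
    [AddCommGroup S] [Module k S]
    [Module (MonoidAlgebra k Γ) S] [IsScalarTower k (MonoidAlgebra k Γ) S]
    (j : ρ.asModule →ₗ[MonoidAlgebra k Γ] E) (hj : Function.Injective j)
    (q : E →ₗ[MonoidAlgebra k Γ] Q) (hq : Function.Surjective q) (hex : Function.Exact j q)
    (v : S →ₗ[MonoidAlgebra k Γ] Q) (σ : Coaction k A S)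
    (hσ : ∀ g, σ.pointAction (ι g) = Representation.ofModule' S g) :
    ∃ v' : S →ₗ[MonoidAlgebra k Γ] E, q ∘ₗ v' = v := by
  obtain ⟨v', hv', hv⟩ := exists_equivariant_lift (ρN := Representation.ofModule' (k := k) E)
    (ρP := Representation.ofModule' (k := k) Q) hι hM
    (j.restrictScalars k ∘ₗ ρ.asModuleEquiv.symm.toLinearMap) (q.restrictScalars k)
    (fun g x => by
      change j (ρ.asModuleEquiv.symm (ρ g x)) =
        MonoidAlgebra.of k Γ g • j (ρ.asModuleEquiv.symm x)
      rw [Representation.asModuleEquiv_symm_map_rho, map_smul])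
    (fun g x => q.map_smul _ x) hj hq hex σ (v.restrictScalars k)
    (fun g x => by
      rw [hσ]
      exact v.map_smul _ x)
  refine ⟨linearMapOfCommutes v' fun g x => ?_, ?_⟩
  · have h1 := hv' g x
    rw [hσ] at h1
    exact h1
  · ext x
    exact LinearMap.congr_fun hv x

/-- If all irreducible representations of a finite group of rational points are restrictions of
modules over the group scheme, a representation is injective when the induced module is. -/
theorem injective_of_ind_isInjective (hι : Function.Injective ι)
    (hirr : ∀ (S : Type u) [AddCommGroup S] [Module k S] (ρ : Representation k Γ S),
      ρ.IsIrreducible → ∃ σ : Coaction k A S, ∀ g, σ.pointAction (ι g) = ρ g)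
    (ρ : Representation k Γ M) (hM : (ind ι ρ).IsInjective) :
    Module.Injective (MonoidAlgebra k Γ) ρ.asModule := by
  obtain ⟨E, _, _, _, j, hj⟩ := Module.exists_injective_embedding (MonoidAlgebra k Γ) ρ.asModule
  refine Module.injective_of_forall_simple_lift j hj fun S _ _ _ v => ?_
  -- restriction of scalars along `k → k[Γ]`
  let _ : Module k E := Module.compHom E (algebraMap k (MonoidAlgebra k Γ))
  have : IsScalarTower k (MonoidAlgebra k Γ) E := .of_algebraMap_smul fun _ _ => rfl
  let _ : Module k S := Module.compHom S (algebraMap k (MonoidAlgebra k Γ))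
  have : IsScalarTower k (MonoidAlgebra k Γ) S := .of_algebraMap_smul fun _ _ => rfl
  obtain ⟨σ, hσ⟩ := hirr S (Representation.ofModule' S) (isIrreducible_ofModule' S)
  exact exists_linear_lift_of_ind_isInjective hι ρ hM j hj _ (Submodule.mkQ_surjective _)
    (LinearMap.exact_map_mkQ_range j) v σ hσ

end InjectiveOfInd

end

theorem mainTheorem4 {k : Type u} [Field k] (p r : ℕ) [Fact p.Prime] [CharP k p]
    [Algebra (ZMod p) k] (hr : 0 < r) [Algebra (GaloisField p r) k]
    (R : Type u) [CommRing R] [HopfAlgebra (ZMod p) R]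
    (hG : IsLinearAlgebraicGroup k (k ⊗[ZMod p] R))
    (H : Subgroup (WithConv ((k ⊗[ZMod p] R) →ₐ[k] k)))
    (hH : (H : Set (WithConv ((k ⊗[ZMod p] R) →ₐ[k] k))) ⊆
      rationalPoints p k (GaloisField p r) R)
    (hF : ∀ h ∈ H, (frobeniusOnPoints p k R)^[r] h ∈ H) :
    (∀ (M : Type u) [AddCommGroup M] [Module k M] (ρ : Representation k H M),
      (ind H.subtype ρ).IsMockInjective p) ∧
    ((∀ (S : Type u) [AddCommGroup S] [Module k S] (ρ : Representation k H S), ρ.IsIrreducible →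
        ∃ σ : Coaction k (k ⊗[ZMod p] R) S, ∀ h : H, σ.pointAction h = ρ h) →
      ∀ (M : Type u) [AddCommGroup M] [Module k M] (ρ : Representation k H M),
        (ind H.subtype ρ).IsProperMockInjective p ↔
          ¬ Module.Injective (MonoidAlgebra k H) ρ.asModule) := by
  have : Algebra.FinitePresentation k (k ⊗[ZMod p] R) := hG.smooth.finitePresentation
  have hmock : ∀ (M : Type u) [AddCommGroup M] [Module k M] (ρ : Representation k H M),
      (ind H.subtype ρ).IsMockInjective p := fun M _ _ ρ => ind_isMockInjective hr H hH ρ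
  have : Finite H := (finite_rationalPoints.subset hH).to_subtype
  refine ⟨hmock, fun hirr M _ _ ρ => ?_⟩
  rw [Coaction.IsProperMockInjective, and_iff_right (hmock M ρ), not_iff_not]
  exact ⟨injective_of_ind_isInjective H.subtype_injective hirr ρ, ind_isInjective H.subtype ρ⟩
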